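/- **Minkowski formula in a hyperbolic ball.** Let $n\ge 1$ and let $\mathbb H^{n+1}$ be the Poincaré ball model of hyperbolic space, that is, the open unit ball of $\mathbb R^{n+1}$ with the metric $\bar g=\frac{4}{(1-|x|^2)^2}\langle\cdot,\cdot\rangle$ and Levi-Civita connection $\bar\nabla$. Let $R>0$, let $B_R^{\mathbb H}$ be the closed hyperbolic ball of hyperbolic radius $R$ centred at the origin, which is the Euclidean ball of radius $R_{\mathbb R}=\sqrt{\frac{\cosh R-1}{\cosh R+1}}\in(0,1)$, and let $\bar N=\frac{1}{\sinh R}x$ be the outward unit normal of $\partial B_R^{\mathbb H}$. Let $M$ be a compact smooth $n$-manifold with (possibly empty) boundary and let $x:M\to B_R^{\mathbb H}$ be a smooth immersion that maps $\operatorname{int}M$ into $\operatorname{int}B_R^{\mathbb H}$ and $\partial M$ into $\partial B_R^{\mathbb H}$. Give $M$ the induced metric $g=x^*\bar g$ with area element $dA$. Let $\nu$ be a smooth unit normal field along $x$, let $h(v,w)=\bar g(\bar\nabla_v\nu,dx(w))$ and $H=\operatorname{tr}_g h$. Let $\theta\in(0,\pi)$ and suppose that $\partial M$ meets $\partial B_R^{\mathbb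 H}$ at the constant angle $\theta$, that is, the angle between $-\nu$ and $\bar N$ is $\theta$ along $\partial M$: $\bar g(-\nu,\bar N)=\cos\theta$. For $a\in\mathbb R^{n+1}$ put $$V_a=\frac{2\langle x,a\rangle}{1-|x|^2},\qquad X_a=\frac{2}{1-R_{\mathbb R}^2}\Big[\langle x,a\rangle x-\tfrac12\big(|x|^2+R_{\mathbb R}^2\big)a\Big],\qquad Y_a=\tfrac12\big(|x|^2+1\big)a-\langle x,a\rangle x .$$ Then both integrands below are integrable with respect to $dA$, and $$\int_M n\,\big(V_a+\sinh R\,\cos\theta\;\bar g(Y_a,\nu)\big)\,dA=\int_M H\,\bar g(X_a,\nu)\,dA .$$ -/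

import Mathlib

open scoped Manifold ContDiff
open MeasureTheory

noncomputable section

namespace PoincareBall

/-! ## The Poincare ball model

`E` is the Euclidean space `ℝⁿ⁺¹`. Hyperbolic space is the open unit ball of `E` with the metric
`e^{2u} ⟨·,·⟩`, where `e^u = 2 / (1 - |x|²)`. Tangent vectors at a point are elements of `E`. -/

section Ambient

variable {E : Type*} [NormedAddCommGroup E] [InnerProductSpace ℝ E]

/-- The conformal factor `e^u = 2 / (1 - |x|²)`. -/
def confFactor (x : E) : ℝ := 2 / (1 - ‖x‖ ^ 2)

/-- The hyperbolic metric at the point `x`, applied to the vectors `v` and `w`. -/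
def hypMetric (x v w : E) : ℝ := confFactor x ^ 2 * inner ℝ v w

/-- The Christoffel bilinear map at `x` of the Levi-Civita connection of the hyperbolic metric:
for constant fields `v`, `w`, the covariant derivative of `w` in the direction `v`. -/
def christoffel (x v w : E) : E :=
  confFactor x • (inner ℝ x v • w + inner ℝ x w • v - inner ℝ v w • x)

/-- The connection has no torsion. -/
theorem christoffel_symm (x v w : E) : christoffel x v w = christoffel x w v := by
  unfold christoffel
  rw [real_inner_comm v w]
  congr 2
  exact add_comm _ _

/-- The connection is compatible with the hyperbolic metric, so that it is the Levi-Civita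
connection. -/
theorem hasDerivAt_hypMetric (x z v w : E) (hx : ‖x‖ < 1) :
    HasDerivAt (fun t : ℝ => hypMetric (x + t • z) v w)
      (hypMetric x (christoffel x z v) w + hypMetric x v (christoffel x z w)) 0 := by
  have h0 : (1 - ‖x‖ ^ 2) ≠ 0 := by nlinarith [norm_nonneg x]
  have h1 : HasDerivAt (fun t : ℝ => x + t • z) z 0 := by
    simpa using ((hasDerivAt_id (0 : ℝ)).smul_const z).const_add x
  have h2 := h1.norm_sq
  have h3 : HasDerivAt (fun t : ℝ => 2 / (1 - ‖x + t • z‖ ^ 2)) _ 0 :=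
    (hasDerivAt_const (0 : ℝ) (2 : ℝ)).div (h2.const_sub 1) (by simpa using h0)
  have h4 := (h3.pow 2).mul_const (inner ℝ v w)
  refine h4.congr_deriv ?_
  simp only [zero_smul, add_zero, hypMetric, christoffel, confFactor, inner_smul_left,
    inner_smul_right, inner_add_left, inner_add_right, inner_sub_left, inner_sub_right,
    RCLike.conj_to_real, real_inner_comm w x, real_inner_comm z v, real_inner_comm x v]
  set q := 1 - ‖x‖ ^ 2
  field_simp
  ring_nf
  rw [mul_inv_cancel₀ h0]
  ring

/-- The hyperbolic distance `r` from the origin: `cosh r = (1 + |x|²) / (1 - |x|²)`. -/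
def hypRadius (x : E) : ℝ := Real.arcosh ((1 + ‖x‖ ^ 2) / (1 - ‖x‖ ^ 2))

/-- The open hyperbolic ball of hyperbolic radius `R` about the origin. -/
def openHypBall (R : ℝ) : Set E := {x | ‖x‖ < 1 ∧ hypRadius x < R}

/-- The geodesic sphere of hyperbolic radius `R` about the origin. -/
def hypSphere (R : ℝ) : Set E := {x | ‖x‖ < 1 ∧ hypRadius x = R}

/-- The Euclidean radius of the hyperbolic ball of hyperbolic radius `R`. -/
def euclRadius (R : ℝ) : ℝ := Real.sqrt ((Real.cosh R - 1) / (Real.cosh R + 1))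

theorem euclRadius_lt_one (R : ℝ) : euclRadius R < 1 := by
  have h := Real.one_le_cosh R
  unfold euclRadius
  rw [Real.sqrt_lt' one_pos, div_lt_iff₀ (by linarith)]
  linarith

/-- The geodesic sphere is the Euclidean sphere of radius `euclRadius R`. -/
theorem mem_hypSphere_iff {R : ℝ} (hR : 0 < R) (x : E) :
    x ∈ hypSphere R ↔ ‖x‖ = euclRadius R := by
  have h := Real.one_le_cosh R
  have h2 : euclRadius R ^ 2 = (Real.cosh R - 1) / (Real.cosh R + 1) :=
    Real.sq_sqrt (div_nonneg (by linarith) (by linarith))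
  constructor
  · rintro ⟨h1, h3⟩
    have hp : 0 < 1 - ‖x‖ ^ 2 := by nlinarith [norm_nonneg x]
    have h4 : (1 + ‖x‖ ^ 2) / (1 - ‖x‖ ^ 2) = Real.cosh R := by
      rw [← h3, hypRadius, Real.cosh_arcosh]
      rw [le_div_iff₀ hp]
      nlinarith [norm_nonneg x]
    rw [div_eq_iff hp.ne'] at h4
    rw [euclRadius, eq_comm, Real.sqrt_eq_iff_mul_self_eq (div_nonneg (by linarith)
      (by linarith)) (norm_nonneg x), div_eq_iff (by linarith)]
    nlinarith
  · intro h3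
    have h1 : ‖x‖ < 1 := h3 ▸ euclRadius_lt_one R
    refine ⟨h1, ?_⟩
    have h4 : (1 + ‖x‖ ^ 2) / (1 - ‖x‖ ^ 2) = Real.cosh R := by
      rw [h3, h2]
      field_simp
      ring
    rw [hypRadius, h4, Real.arcosh_cosh hR.le]

/-- The outward unit normal of the geodesic sphere of hyperbolic radius `R`, at `x`. -/
def sphereNormal (R : ℝ) (x : E) : E := (1 / Real.sinh R) • x

/-- The function `V_a = 2⟨x,a⟩ / (1 - |x|²)`. -/
def weightV (a x : E) : ℝ := 2 * inner ℝ x a / (1 - ‖x‖ ^ 2)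

/-- The field `X_a = 2 / (1 - R_ℝ²) (⟨x,a⟩ x - (|x|² + R_ℝ²) a / 2)`, where `R_ℝ = euclRadius R`. -/
def fieldX (R : ℝ) (a x : E) : E :=
  (2 / (1 - euclRadius R ^ 2)) •
    (inner ℝ x a • x - ((1 / 2 : ℝ) * (‖x‖ ^ 2 + euclRadius R ^ 2)) • a)

/-- The field `Y_a = (|x|² + 1) a / 2 - ⟨x,a⟩ x`. -/
def fieldY (a x : E) : E :=
  ((1 / 2 : ℝ) * (‖x‖ ^ 2 + 1)) • a - inner ℝ x a • x

end Ambient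

/-! ## Immersed hypersurfaces

`M` is an `n`-manifold with boundary and `x : M → ℝⁿ⁺¹` takes values in the unit ball. The metric
on `M` is the pullback of the hyperbolic metric. -/

section Hypersurface

variable {n : ℕ} [NeZero n]
  {M : Type*} [TopologicalSpace M] [ChartedSpace (EuclideanHalfSpace n) M]

/-- The differential of `f : M → ℝⁿ⁺¹` at `p`, applied to a tangent vector. -/
def diff (f : M → EuclideanSpace ℝ (Fin (n + 1))) (p : M) (v : TangentSpace (𝓡∂ n) p) :
    EuclideanSpace ℝ (Fin (n + 1)) :=
  mfderiv (𝓡∂ n) (𝓡 (n + 1)) f p v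

/-- The first fundamental form: the metric induced by `x`. -/
def firstForm (x : M → EuclideanSpace ℝ (Fin (n + 1))) (p : M)
    (v w : TangentSpace (𝓡∂ n) p) : ℝ :=
  hypMetric (x p) (diff x p v) (diff x p w)

/-- The hyperbolic covariant derivative of the vector field `ν` along `x` in the direction of the
tangent vector `v` of `M`. -/
def covDeriv (x ν : M → EuclideanSpace ℝ (Fin (n + 1))) (p : M)
    (v : TangentSpace (𝓡∂ n) p) : EuclideanSpace ℝ (Fin (n + 1)) :=
  diff ν p v + christoffel (x p) (diff x p v) (ν p)

/-- The second fundamental form `h(v, w) = ḡ(∇̄_v ν, dx(w))`. -/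
def secondForm (x ν : M → EuclideanSpace ℝ (Fin (n + 1))) (p : M)
    (v w : TangentSpace (𝓡∂ n) p) : ℝ :=
  hypMetric (x p) (covDeriv x ν p v) (diff x p w)

/-- The `i`-th vector of the standard basis of the tangent space at `p`. -/
def tangentBasis (p : M) (i : Fin n) : TangentSpace (𝓡∂ n) p :=
  (EuclideanSpace.single i (1 : ℝ) : EuclideanSpace ℝ (Fin n))

/-- The mean curvature `H = tr_g h`, that is, `∑ i j, gⁱʲ h i j`. -/
def meanCurvature (x ν : M → EuclideanSpace ℝ (Fin (n + 1))) (p : M) : ℝ :=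
  Matrix.trace
    ((Matrix.of fun i j : Fin n => firstForm x p (tangentBasis p i) (tangentBasis p j))⁻¹ *
      Matrix.of fun i j : Fin n => secondForm x ν p (tangentBasis p i) (tangentBasis p j))

/-- The matrix of the induced metric in the coordinates of the preferred chart at `p`, at the
point `y` of the coordinate domain. -/
def coordGram (x : M → EuclideanSpace ℝ (Fin (n + 1))) (p : M) (y : EuclideanSpace ℝ (Fin n)) :
    Matrix (Fin n) (Fin n) ℝ :=
  Matrix.of fun i j =>
    hypMetric (x ((extChartAt (𝓡∂ n) p).symm y))
      (fderivWithin ℝ (x ∘ (extChartAt (𝓡∂ n) p).symm) (Set.range (𝓡∂ n)) y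
        (EuclideanSpace.single i 1))
      (fderivWithin ℝ (x ∘ (extChartAt (𝓡∂ n) p).symm) (Set.range (𝓡∂ n)) y
        (EuclideanSpace.single j 1))

/-- The Riemannian measure of the induced metric on the domain of the preferred chart at `p`,
extended by zero: `√(det g) dy` in coordinates. -/
def chartArea [MeasurableSpace M] (x : M → EuclideanSpace ℝ (Fin (n + 1))) (p : M) : Measure M :=
  (((volume : Measure (EuclideanSpace ℝ (Fin n))).restrict
      (extChartAt (𝓡∂ n) p).target).withDensity
        fun y => ENNReal.ofReal (Real.sqrt (coordGram x p y).det)).map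
    (extChartAt (𝓡∂ n) p).symm

/-- The area measure `dA` of the induced metric. The measures `chartArea x p` agree on the overlaps
of the chart domains, so that their least upper bound is the measure on `M` that restricts to
`chartArea x p` on each chart domain. -/
def area [MeasurableSpace M] (x : M → EuclideanSpace ℝ (Fin (n + 1))) : Measure M :=
  ⨆ p : M, chartArea x p

end Hypersurface

end PoincareBall

end

/-! Put c = sinh R cos θ and write e^u for the conformal factor. Along M consider `minkowskiField`,
the field Z = (X_a - ḡ(X_a, ν) ν) + c (ḡ(ν, ∇V_a) x - ḡ(ν, x) ∇V_a). Both summands are orthogonal to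
ν, so Z is tangent to M. The Minkowski formula says that the divergence of Z integrates to zero.

Divergence. The fields ∇V_a and x are conformal: ∇̄_v ∇V_a = V_a v and ∇̄_v x = V_0 v with V_0 = (1
+ |x|²) / (1 - |x|²). The field X_a is a combination of ∇V_a and the constant field a, normalised to
have divergence n V_a along M. So the first summand has divergence n V_a - H ḡ(X_a, ν). In the
second, the derivatives of the coefficients give h(xᵀ, ∇V_aᵀ) - h(∇V_aᵀ, xᵀ) = 0
(`rotation_terms_cancel`), and n c ḡ(V_0 ∇V_a - V_a x, ν) = n c ḡ(Y_a, ν) remains.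

Boundary. On the sphere X_a is orthogonal to x and e^{2u} (|x|² ∇V_a - ⟨∇V_a, x⟩ x) = -X_a. The
angle condition reads c = -ḡ(ν, x), so the contributions to ⟨Z, x⟩ cancel
(`inner_minkowskiField_of_norm_eq`). As sin θ ≠ 0, M is transversal to the sphere, hence Z is
tangent to ∂M and the boundary flux vanishes.

The divergence theorem is obtained from a partition of unity and the divergence theorem on a box: in
a chart, √(det g) times the coordinate vector of Z has Euclidean divergence √(det g) div Z
(`exists_hasFDerivAt_density_smul`).

Since the metric is conformal to the Euclidean one, tangential projections and traces are Euclidean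
and use the pseudo-inverse (A*A)⁻¹A* of the differential A. Of the three Christoffel terms in a
divergence two cancel, the projection being symmetric; the third is the summand n e^u ⟨x, z⟩ of
`divAlong`. -/

noncomputable section

set_option linter.unusedSectionVars false

namespace PoincareBall

/-! ### Pseudo-inverses and traces along an injective linear map -/

section LinearAlgebra

variable {V W : Type*} [NormedAddCommGroup V] [InnerProductSpace ℝ V] [FiniteDimensional ℝ V]
  [NormedAddCommGroup W] [InnerProductSpace ℝ W] [FiniteDimensional ℝ W]

/-- The left inverse of an injective linear map which vanishes on the orthogonal complement of the
range. -/
def leftInv (A : V →L[ℝ] W) : W →L[ℝ] V :=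
  Ring.inverse (ContinuousLinearMap.adjoint A ∘L A) ∘L ContinuousLinearMap.adjoint A

theorem isUnit_adjoint_comp_self {A : V →L[ℝ] W} (hA : Function.Injective A) :
    IsUnit (ContinuousLinearMap.adjoint A ∘L A) := by
  have h : Function.Injective (ContinuousLinearMap.adjoint A ∘L A) := by
    rw [injective_iff_map_eq_zero]
    intro v hv
    apply (injective_iff_map_eq_zero A).1 hA
    have h1 : inner ℝ (A v) (A v) = 0 := by
      rw [← ContinuousLinearMap.adjoint_inner_right]
      have : ContinuousLinearMap.adjoint A (A v) = 0 := hv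
      rw [this, inner_zero_right]
    exact inner_self_eq_zero.1 h1
  rw [ContinuousLinearMap.isUnit_iff_bijective]
  exact ⟨h, LinearMap.injective_iff_surjective.1 h⟩

theorem leftInv_apply {A : V →L[ℝ] W} (hA : Function.Injective A) (v : V) :
    leftInv A (A v) = v :=
  congrArg (fun f : V →L[ℝ] V => f v)
    (Ring.inverse_mul_cancel _ (isUnit_adjoint_comp_self hA))

theorem inner_apply_leftInv {A : V →L[ℝ] W} (hA : Function.Injective A) (z : W) (v : V) :
    inner ℝ (A (leftInv A z)) (A v) = inner ℝ z (A v) := by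
  have h := congrArg (fun f : V →L[ℝ] V => f (ContinuousLinearMap.adjoint A z))
    (Ring.mul_inverse_cancel _ (isUnit_adjoint_comp_self hA))
  have h' : ContinuousLinearMap.adjoint A (A (leftInv A z)) = ContinuousLinearMap.adjoint A z := h
  rw [← ContinuousLinearMap.adjoint_inner_left, h', ContinuousLinearMap.adjoint_inner_left]

theorem leftInv_eq_zero {A : V →L[ℝ] W} {z : W} (hz : ∀ v, inner ℝ z (A v) = 0) :
    leftInv A z = 0 := by
  have h : ContinuousLinearMap.adjoint A z = 0 := by
    refine ext_inner_right ℝ fun v => ?_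
    rw [ContinuousLinearMap.adjoint_inner_left, hz, inner_zero_left]
  simp [leftInv, h]

/-- In codimension one the complement of the range is the line of `ν`, so the orthogonal projection
`A ∘ leftInv A` removes only the `ν`-component. -/
theorem apply_leftInv {A : V →L[ℝ] W} (hA : Function.Injective A)
    (hd : Module.finrank ℝ W = Module.finrank ℝ V + 1) {ν : W} (hν : ν ≠ 0)
    (hA' : ∀ v, inner ℝ ν (A v) = 0) (z : W) :
    A (leftInv A z) = z - (inner ℝ ν z / ‖ν‖ ^ 2) • ν := by
  set K : Submodule ℝ W := LinearMap.range (A : V →ₗ[ℝ] W) with hK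
  have hKd : Module.finrank ℝ K = Module.finrank ℝ V := LinearMap.finrank_range_of_inj hA
  have h1 : Module.finrank ℝ Kᗮ = 1 := by
    have := K.finrank_add_finrank_orthogonal
    omega
  have hmem : ∀ w : W, (∀ v, inner ℝ w (A v) = 0) → w ∈ Kᗮ := by
    intro w hw
    rw [Submodule.mem_orthogonal']
    rintro _ ⟨v, rfl⟩
    exact hw v
  obtain ⟨c, hc⟩ := (finrank_eq_one_iff_of_nonzero' (⟨ν, hmem ν hA'⟩ : Kᗮ)
    (by simpa [Subtype.ext_iff] using hν)).1 h1
      ⟨z - A (leftInv A z), hmem _ fun v => by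
        rw [inner_sub_left, inner_apply_leftInv hA, sub_self]⟩
  have hc' : c • ν = z - A (leftInv A z) := congrArg Subtype.val hc
  have h2 : c * ‖ν‖ ^ 2 = inner ℝ ν z := by
    have := congrArg (fun w => inner ℝ ν w) hc'
    simpa [inner_smul_right, inner_sub_right, hA', real_inner_self_eq_norm_sq] using this
  have h3 : ‖ν‖ ^ 2 ≠ 0 := by positivity
  rw [← h2, mul_div_assoc, div_self h3, mul_one, hc']
  abel

/-- The range of `A` and `ν` together span `W`. This characterisation does not involve the inner
product of `V`, hence survives coordinate changes that are not isometries. -/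
theorem leftInv_eq_of_leftInverse {A : V →L[ℝ] W} (hA : Function.Injective A)
    (hd : Module.finrank ℝ W = Module.finrank ℝ V + 1) {ν : W} (hν : ν ≠ 0)
    (hA' : ∀ v, inner ℝ ν (A v) = 0) {P : W →L[ℝ] V} (hP : ∀ v, P (A v) = v) (hPν : P ν = 0) :
    P = leftInv A := by
  ext z
  have h := apply_leftInv hA hd hν hA' z
  have h2 := congrArg P h
  rw [hP, map_sub, map_smul, hPν, smul_zero, sub_zero] at h2
  exact h2.symm

/-- The trace of `B` along the injective map `A`. -/
def traceAlong (A B : V →L[ℝ] W) : ℝ :=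
  LinearMap.trace ℝ V ((leftInv A ∘L B : V →L[ℝ] V) : V →ₗ[ℝ] V)

theorem traceAlong_add (A B C : V →L[ℝ] W) :
    traceAlong A (B + C) = traceAlong A B + traceAlong A C := by
  unfold traceAlong
  rw [ContinuousLinearMap.comp_add, ContinuousLinearMap.toLinearMap_add, map_add]

theorem traceAlong_smul (A B : V →L[ℝ] W) (c : ℝ) :
    traceAlong A (c • B) = c * traceAlong A B := by
  unfold traceAlong
  rw [ContinuousLinearMap.comp_smul, ContinuousLinearMap.toLinearMap_smul, map_smul, smul_eq_mul]

theorem traceAlong_self {A : V →L[ℝ] W} (hA : Function.Injective A) :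
    traceAlong A A = Module.finrank ℝ V := by
  have : (leftInv A ∘L A : V →L[ℝ] V) = ContinuousLinearMap.id ℝ V := by
    ext v
    exact leftInv_apply hA v
  rw [traceAlong, this]
  exact LinearMap.trace_id ℝ V

theorem traceAlong_smulRight (A : V →L[ℝ] W) (l : V →L[ℝ] ℝ) (c : W) :
    traceAlong A (l.smulRight c) = l (leftInv A c) := by
  have : ((leftInv A ∘L l.smulRight c : V →L[ℝ] V) : V →ₗ[ℝ] V)
      = (l : V →ₗ[ℝ] ℝ).smulRight (leftInv A c) := by
    ext v
    simp
  rw [traceAlong, this, LinearMap.trace_smulRight]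
  rfl

theorem leftInv_comp_equiv {V' : Type*} [NormedAddCommGroup V'] [InnerProductSpace ℝ V']
    [FiniteDimensional ℝ V'] {A : V →L[ℝ] W} (hA : Function.Injective A)
    (hd : Module.finrank ℝ W = Module.finrank ℝ V + 1) {ν : W} (hν : ν ≠ 0)
    (hA' : ∀ v, inner ℝ ν (A v) = 0) (L : V' ≃L[ℝ] V) :
    leftInv (A ∘L (L : V' →L[ℝ] V)) = (L.symm : V →L[ℝ] V') ∘L leftInv A := by
  refine (leftInv_eq_of_leftInverse (A := A ∘L (L : V' →L[ℝ] V)) (hA.comp L.injective)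
    (by rw [hd, L.toLinearEquiv.finrank_eq]) hν (fun v => hA' _) (fun v => ?_) ?_).symm
  · simp [leftInv_apply hA]
  · simp [leftInv_eq_zero hA']

/-- A coordinate change conjugates `leftInv A ∘L B`. Hence divergences and the mean curvature may be
computed in any chart. -/
theorem traceAlong_comp_equiv {V' : Type*} [NormedAddCommGroup V'] [InnerProductSpace ℝ V']
    [FiniteDimensional ℝ V'] {A : V →L[ℝ] W} (hA : Function.Injective A)
    (hd : Module.finrank ℝ W = Module.finrank ℝ V + 1) {ν : W} (hν : ν ≠ 0)
    (hA' : ∀ v, inner ℝ ν (A v) = 0) (L : V' ≃L[ℝ] V) (B : V →L[ℝ] W) :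
    traceAlong (A ∘L (L : V' →L[ℝ] V)) (B ∘L (L : V' →L[ℝ] V)) = traceAlong A B := by
  have h : (((leftInv (A ∘L (L : V' →L[ℝ] V))) ∘L (B ∘L (L : V' →L[ℝ] V)) : V' →L[ℝ] V') :
        V' →ₗ[ℝ] V')
      = L.symm.toLinearEquiv.conj ((leftInv A ∘L B : V →L[ℝ] V) : V →ₗ[ℝ] V) := by
    rw [leftInv_comp_equiv hA hd hν hA']
    ext v
    rfl
  rw [traceAlong, h, LinearMap.trace_conj']
  rfl

theorem contDiff_adjoint :
    ContDiff ℝ ∞ (fun A : V →L[ℝ] W => ContinuousLinearMap.adjoint A) := by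
  let l : (V →L[ℝ] W) →ₗ[ℝ] (W →L[ℝ] V) :=
    { toFun := fun A => ContinuousLinearMap.adjoint A
      map_add' := fun A B => map_add _ A B
      map_smul' := fun c A => by simp }
  exact l.toContinuousLinearMap.contDiff

theorem contDiff_adjoint_comp_self :
    ContDiff ℝ ∞ (fun A : V →L[ℝ] W => ContinuousLinearMap.adjoint A ∘L A) :=
  ContDiff.clm_comp contDiff_adjoint contDiff_id

theorem contDiffAt_inverse_of_isUnit {B : V →L[ℝ] V} (hB : IsUnit B) :
    ContDiffAt ℝ ∞ (Ring.inverse : (V →L[ℝ] V) → (V →L[ℝ] V)) B := by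
  have : CompleteSpace V := FiniteDimensional.complete ℝ V
  exact hB.unit_spec ▸ contDiffAt_ringInverse ℝ hB.unit

theorem contDiffAt_leftInv {A : V →L[ℝ] W} (hA : Function.Injective A) :
    ContDiffAt ℝ ∞ (fun A : V →L[ℝ] W => leftInv A) A := by
  have h : ContDiffAt ℝ ∞
      (fun A : V →L[ℝ] W => Ring.inverse (ContinuousLinearMap.adjoint A ∘L A)) A :=
    ContDiffAt.fun_comp A (g := (Ring.inverse : (V →L[ℝ] V) → (V →L[ℝ] V)))
      (contDiffAt_inverse_of_isUnit (isUnit_adjoint_comp_self hA))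
      contDiff_adjoint_comp_self.contDiffAt
  exact h.clm_comp contDiff_adjoint.contDiffAt

end LinearAlgebra

/-! ### Gram matrices in coordinates -/

section Gram

variable {n : ℕ} {W : Type*} [NormedAddCommGroup W] [InnerProductSpace ℝ W]
  [FiniteDimensional ℝ W]

/-- The matrix `c² ⟨B eᵢ, A eⱼ⟩`. -/
def pairMatrix (c : ℝ) (B A : EuclideanSpace ℝ (Fin n) →L[ℝ] W) : Matrix (Fin n) (Fin n) ℝ :=
  Matrix.of fun i j => c ^ 2 * inner ℝ (B (EuclideanSpace.single i 1)) (A (EuclideanSpace.single j 1))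

theorem det_pairMatrix_self_pos {c : ℝ} (hc : c ≠ 0) {A : EuclideanSpace ℝ (Fin n) →L[ℝ] W}
    (hA : Function.Injective A) : 0 < (pairMatrix c A A).det := by
  have h1 : pairMatrix c A A
      = c ^ 2 • Matrix.gram ℝ (fun i => A (EuclideanSpace.single i (1 : ℝ))) := by
    ext i j
    simp [pairMatrix, Matrix.gram]
  have hli : LinearIndependent ℝ (fun i : Fin n => A (EuclideanSpace.single i (1 : ℝ))) := by
    have h := (EuclideanSpace.basisFun (Fin n) ℝ).toBasis.linearIndependent
    have := h.map' (A : EuclideanSpace ℝ (Fin n) →ₗ[ℝ] W) (LinearMap.ker_eq_bot.2 hA)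
    have e : (fun i : Fin n => A (EuclideanSpace.single i (1 : ℝ)))
        = (A : EuclideanSpace ℝ (Fin n) →ₗ[ℝ] W) ∘
          (EuclideanSpace.basisFun (Fin n) ℝ).toBasis := by
      ext i
      simp
    rw [e]
    exact this
  rw [h1, Matrix.det_smul]
  have := (Matrix.posDef_gram_of_linearIndependent hli).det_pos
  positivity

/-- Pairing with the range of `A` sees only the projection of `B` to that range; expand `leftInv A
∘L B` in the standard basis. -/
theorem pairMatrix_eq (c : ℝ) {A : EuclideanSpace ℝ (Fin n) →L[ℝ] W}
    (hA : Function.Injective A) (B : EuclideanSpace ℝ (Fin n) →L[ℝ] W) :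
    pairMatrix c B A = (LinearMap.toMatrix (EuclideanSpace.basisFun (Fin n) ℝ).toBasis
      (EuclideanSpace.basisFun (Fin n) ℝ).toBasis
        ((leftInv A ∘L B : _ →L[ℝ] _) : _ →ₗ[ℝ] _)).transpose * pairMatrix c A A := by
  ext i j
  set T := (leftInv A ∘L B : EuclideanSpace ℝ (Fin n) →L[ℝ] EuclideanSpace ℝ (Fin n))
  have h1 : T (EuclideanSpace.single i 1) = ∑ k, T (EuclideanSpace.single i 1) k •
      EuclideanSpace.single k (1 : ℝ) := by
    ext l
    simp [Finset.sum_apply, Pi.single_apply]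
  have h2 : inner ℝ (B (EuclideanSpace.single i 1)) (A (EuclideanSpace.single j 1))
      = inner ℝ (A (T (EuclideanSpace.single i 1))) (A (EuclideanSpace.single j 1)) :=
    (inner_apply_leftInv hA _ _).symm
  rw [Matrix.mul_apply]
  simp only [pairMatrix, Matrix.of_apply, Matrix.transpose_apply]
  rw [h2, h1, map_sum, sum_inner, Finset.mul_sum]
  refine Finset.sum_congr rfl fun k _ => ?_
  rw [map_smul, real_inner_smul_left]
  have h3 : (LinearMap.toMatrix (EuclideanSpace.basisFun (Fin n) ℝ).toBasis
      (EuclideanSpace.basisFun (Fin n) ℝ).toBasis (T : _ →ₗ[ℝ] _)) k i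
        = T (EuclideanSpace.single i 1) k := by
    rw [LinearMap.toMatrix_apply]
    simp
  rw [h3]
  ring

theorem trace_inv_mul_pairMatrix {c : ℝ} (hc : c ≠ 0) {A : EuclideanSpace ℝ (Fin n) →L[ℝ] W}
    (hA : Function.Injective A) (B : EuclideanSpace ℝ (Fin n) →L[ℝ] W) :
    Matrix.trace ((pairMatrix c A A)⁻¹ * pairMatrix c B A) = traceAlong A B := by
  have hu : IsUnit (pairMatrix c A A).det := (det_pairMatrix_self_pos hc hA).ne'.isUnit
  rw [pairMatrix_eq c hA B, Matrix.trace_mul_comm, Matrix.mul_assoc, Matrix.mul_nonsing_inv _ hu,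
    Matrix.mul_one, Matrix.trace_transpose, traceAlong,
    LinearMap.trace_eq_matrix_trace ℝ (EuclideanSpace.basisFun (Fin n) ℝ).toBasis]

theorem trace_inv_mul_pairMatrix' {c : ℝ} (hc : c ≠ 0) {A : EuclideanSpace ℝ (Fin n) →L[ℝ] W}
    (hA : Function.Injective A) (B : EuclideanSpace ℝ (Fin n) →L[ℝ] W) :
    Matrix.trace ((pairMatrix c A A)⁻¹ * pairMatrix c A B) = traceAlong A B := by
  have h1 : ∀ B C : EuclideanSpace ℝ (Fin n) →L[ℝ] W,
      (pairMatrix c B C).transpose = pairMatrix c C B := by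
    intro B C
    ext i j
    simp [pairMatrix, real_inner_comm]
  rw [← trace_inv_mul_pairMatrix hc hA B, ← Matrix.trace_transpose, Matrix.transpose_mul, h1,
    Matrix.transpose_nonsing_inv, h1, Matrix.trace_mul_comm]

theorem pairMatrix_comp_self (c : ℝ) (A : EuclideanSpace ℝ (Fin n) →L[ℝ] W)
    (L : EuclideanSpace ℝ (Fin n) →L[ℝ] EuclideanSpace ℝ (Fin n)) :
    (pairMatrix c (A ∘L L) (A ∘L L)).det = L.det ^ 2 * (pairMatrix c A A).det := by
  set m := LinearMap.toMatrix (EuclideanSpace.basisFun (Fin n) ℝ).toBasis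
      (EuclideanSpace.basisFun (Fin n) ℝ).toBasis (L : _ →ₗ[ℝ] _) with hm
  have h0 : ∀ i, L (EuclideanSpace.single i 1) = ∑ k, m k i • EuclideanSpace.single k (1 : ℝ) := by
    intro i
    ext l
    simp [hm, LinearMap.toMatrix_apply, Finset.sum_apply, Pi.single_apply]
  have h1 : pairMatrix c (A ∘L L) (A ∘L L) = m.transpose * pairMatrix c A A * m := by
    ext i j
    rw [Matrix.mul_apply]
    simp only [Matrix.mul_apply, pairMatrix, Matrix.of_apply, Matrix.transpose_apply,
      ContinuousLinearMap.comp_apply, h0, map_sum, map_smul, sum_inner, inner_sum,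
      real_inner_smul_left, real_inner_smul_right, Finset.mul_sum, Finset.sum_mul]
    refine Finset.sum_congr rfl fun k _ => Finset.sum_congr rfl fun l _ => ?_
    ring
  have h2 : m.det = L.det := by
    rw [hm, LinearMap.det_toMatrix]
  rw [h1, Matrix.det_mul, Matrix.det_mul, Matrix.det_transpose, h2]
  ring

end Gram

/-! ### The tangential field and its hyperbolic divergence -/

section Fields

variable {V W : Type*} [NormedAddCommGroup V] [InnerProductSpace ℝ V] [FiniteDimensional ℝ V]
  [NormedAddCommGroup W] [InnerProductSpace ℝ W] [FiniteDimensional ℝ W]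

theorem confFactor_mul {x : W} (hx : ‖x‖ < 1) : confFactor x * (1 - ‖x‖ ^ 2) = 2 := by
  have : 1 - ‖x‖ ^ 2 ≠ 0 := by nlinarith [norm_nonneg x]
  rw [confFactor, div_mul_cancel₀ _ this]

theorem confFactor_pos {x : W} (hx : ‖x‖ < 1) : 0 < confFactor x := by
  have : 0 < 1 - ‖x‖ ^ 2 := by nlinarith [norm_nonneg x]
  unfold confFactor
  positivity

/-- The gradient of `V_a`. -/
def gradV (a x : W) : W := ((1 / 2 : ℝ) * (1 - ‖x‖ ^ 2)) • a + inner ℝ x a • x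

/-- The tangential field on the hypersurface whose divergence is the difference of the two sides of
the Minkowski formula. -/
def minkowskiField (R c : ℝ) (a x ν : W) : W :=
  fieldX R a x - hypMetric x (fieldX R a x) ν • ν +
    c • (hypMetric x ν (gradV a x) • x - hypMetric x ν x • gradV a x)

/-- The hyperbolic divergence along an immersion with differential `A` of a vector field with value
`z` at the point `x` and with Euclidean derivative `B`. -/
def divAlong (A B : V →L[ℝ] W) (x z : W) : ℝ :=
  traceAlong A B + Module.finrank ℝ V * (confFactor x * inner ℝ x z)

theorem divAlong_add (A B C : V →L[ℝ] W) (x z w : W) :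
    divAlong A (B + C) x (z + w) = divAlong A B x z + divAlong A C x w := by
  unfold divAlong
  rw [traceAlong_add, inner_add_right]
  ring

theorem divAlong_smul (A B : V →L[ℝ] W) (x z : W) (c : ℝ) (l : V →L[ℝ] ℝ) :
    divAlong A (c • B + l.smulRight z) x (c • z) = c * divAlong A B x z + l (leftInv A z) := by
  unfold divAlong
  rw [traceAlong_add, traceAlong_smul, traceAlong_smulRight, real_inner_smul_right]
  ring

theorem divAlong_const_smul (A B : V →L[ℝ] W) (x z : W) (c : ℝ) :
    divAlong A (c • B) x (c • z) = c * divAlong A B x z := by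
  unfold divAlong
  rw [traceAlong_smul, real_inner_smul_right]
  ring

variable {F N : V → W} {A B : V →L[ℝ] W} {y : V}

theorem hasFDerivAt_confFactor (hF : HasFDerivAt F A y) (h1 : ‖F y‖ < 1) :
    HasFDerivAt (fun z => confFactor (F z))
      (confFactor (F y) ^ 2 • (innerSL ℝ (F y) ∘L A)) y := by
  have h0 : 1 - ‖F y‖ ^ 2 ≠ 0 := by nlinarith [norm_nonneg (F y)]
  have h2 := ((hasDerivAt_inv h0).comp_hasFDerivAt y (hF.norm_sq.const_sub 1)).const_mul 2
  unfold confFactor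
  simp only [div_eq_mul_inv]
  refine h2.congr_fderiv ?_
  ext v
  simp
  field_simp

theorem exists_hasFDerivAt_hypMetric {X Y : V → W} {X' Y' : V →L[ℝ] W} (hF : HasFDerivAt F A y)
    (h1 : ‖F y‖ < 1) (hX : HasFDerivAt X X' y) (hY : HasFDerivAt Y Y' y) :
    ∃ l : V →L[ℝ] ℝ, HasFDerivAt (fun z => hypMetric (F z) (X z) (Y z)) l y ∧
      ∀ v, l v = 2 * confFactor (F y) ^ 3 * inner ℝ (F y) (A v) * inner ℝ (X y) (Y y) +
        confFactor (F y) ^ 2 * (inner ℝ (X' v) (Y y) + inner ℝ (X y) (Y' v)) := by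
  refine ⟨_, ((hasFDerivAt_confFactor hF h1).pow 2).mul (hX.inner ℝ hY), fun v => ?_⟩
  simp [fderivInnerCLM_apply]
  ring

theorem hasFDerivAt_gradV (hF : HasFDerivAt F A y) (a : W) :
    HasFDerivAt (fun z => gradV a (F z))
      ((innerSL ℝ a ∘L A).smulRight (F y) + inner ℝ (F y) a • A
        - (innerSL ℝ (F y) ∘L A).smulRight a) y := by
  have h1 := (((hF.norm_sq.const_sub 1).const_mul (1 / 2)).smul_const a).add
    ((hF.inner ℝ (hasFDerivAt_const a y)).smul hF)
  refine h1.congr_fderiv ?_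
  ext v
  simp [fderivInnerCLM_apply, real_inner_comm a]
  module

/-- Up to a factor, X_a differs from ∇V_a by a constant vector, so its Euclidean derivative comes
from that of ∇V_a. -/
theorem fieldX_eq (R : ℝ) (a x : W) :
    fieldX R a x = (2 / (1 - euclRadius R ^ 2)) •
      (gradV a x + (-(1 / 2 : ℝ) * (1 + euclRadius R ^ 2)) • a) := by
  unfold fieldX gradV
  module

theorem euclRadius_sq_lt_one (R : ℝ) : euclRadius R ^ 2 < 1 := by
  have h1 := euclRadius_lt_one R
  have h2 : 0 ≤ euclRadius R := Real.sqrt_nonneg _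
  nlinarith

theorem hasFDerivAt_fieldX (hF : HasFDerivAt F A y) (R : ℝ) (a : W) :
    HasFDerivAt (fun z => fieldX R a (F z))
      ((2 / (1 - euclRadius R ^ 2)) • ((innerSL ℝ a ∘L A).smulRight (F y) + inner ℝ (F y) a • A
        - (innerSL ℝ (F y) ∘L A).smulRight a)) y := by
  simp only [fieldX_eq]
  exact ((hasFDerivAt_gradV hF a).add_const _).const_smul _

theorem inner_apply_leftInv_comm (hA : Function.Injective A) (z w : W) :
    inner ℝ z (A (leftInv A w)) = inner ℝ w (A (leftInv A z)) := by
  rw [← inner_apply_leftInv hA, ← inner_apply_leftInv hA w, real_inner_comm]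

/-- The two rank-one terms have equal traces because the tangential projection is symmetric, and
they cancel. -/
theorem traceAlong_gradV (hA : Function.Injective A) (a x : W) :
    traceAlong A ((innerSL ℝ a ∘L A).smulRight x + inner ℝ x a • A
        - (innerSL ℝ x ∘L A).smulRight a) = Module.finrank ℝ V * inner ℝ x a := by
  rw [sub_eq_add_neg, ← neg_one_smul ℝ, traceAlong_add, traceAlong_add, traceAlong_smul,
    traceAlong_smul, traceAlong_smulRight, traceAlong_smulRight, traceAlong_self hA]
  simp only [ContinuousLinearMap.comp_apply, innerSL_apply_apply]
  rw [inner_apply_leftInv_comm hA x a]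
  ring

theorem weightV_eq (a x : W) : weightV a x = confFactor x * inner ℝ x a := by
  unfold weightV confFactor
  ring

theorem divAlong_gradV (hA : Function.Injective A) (a : W) {x : W} (hx : ‖x‖ < 1) :
    divAlong A ((innerSL ℝ a ∘L A).smulRight x + inner ℝ x a • A
        - (innerSL ℝ x ∘L A).smulRight a) x (gradV a x)
      = Module.finrank ℝ V * weightV a x := by
  have h := confFactor_mul hx
  rw [divAlong, traceAlong_gradV hA, gradV, weightV_eq, inner_add_right, real_inner_smul_right,
    real_inner_smul_right, real_inner_self_eq_norm_sq]
  linear_combination (-(1 / 2 : ℝ)) * Module.finrank ℝ V * inner ℝ x a * h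

/-- The constant field `a` also has divergence n V_a, from the Christoffel term alone. The
combination thus gives (1 - (1 + R_ℝ²) / 2) n V_a, and the prefactor 2 / (1 - R_ℝ²) normalises it.
-/
theorem divAlong_fieldX (hA : Function.Injective A) (R : ℝ) (a : W) {x : W} (hx : ‖x‖ < 1) :
    divAlong A ((2 / (1 - euclRadius R ^ 2)) • ((innerSL ℝ a ∘L A).smulRight x + inner ℝ x a • A
        - (innerSL ℝ x ∘L A).smulRight a)) x (fieldX R a x)
      = Module.finrank ℝ V * weightV a x := by
  have h := confFactor_mul hx
  have h0 : 1 - euclRadius R ^ 2 ≠ 0 := by linarith [euclRadius_sq_lt_one R]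
  have h1 := divAlong_gradV hA a hx
  rw [fieldX_eq, divAlong_const_smul]
  unfold divAlong at h1 ⊢
  rw [weightV_eq] at h1 ⊢
  rw [inner_add_right, real_inner_smul_right]
  have h2 : 2 / (1 - euclRadius R ^ 2) * (1 - euclRadius R ^ 2) = 2 := div_mul_cancel₀ _ h0
  linear_combination (2 / (1 - euclRadius R ^ 2)) * h1 +
    (1 / 2 : ℝ) * Module.finrank ℝ V * confFactor x * inner ℝ x a * h2

theorem gradV_eq (a : W) {x : W} (hx : ‖x‖ < 1) :
    gradV a x = (confFactor x)⁻¹ • a + inner ℝ x a • x := by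
  have h := confFactor_mul hx
  have h0 := (confFactor_pos hx).ne'
  have : (1 / 2 : ℝ) * (1 - ‖x‖ ^ 2) = (confFactor x)⁻¹ := by
    field_simp
    linarith
  rw [gradV, this]

/-- The divergence of `ḡ(ν, ∇V_a) x - ḡ(ν, x) ∇V_a` has no contribution of the derivatives of the
coefficients. -/
theorem rotation_terms_cancel (hA : Function.Injective A)
    (hd : Module.finrank ℝ W = Module.finrank ℝ V + 1) {x ν : W} (a : W) (hx : ‖x‖ < 1)
    (hν : ν ≠ 0) (hAν : ∀ v, inner ℝ ν (A v) = 0)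
    (hB : ∀ v, inner ℝ ν (B v) = -(confFactor x * inner ℝ x (A v) * ‖ν‖ ^ 2))
    (hsymm : ∀ v w, inner ℝ (B v) (A w) = inner ℝ (B w) (A v)) {l m : V →L[ℝ] ℝ}
    (hl : ∀ v, l v = 2 * confFactor x ^ 3 * inner ℝ x (A v) * inner ℝ ν (gradV a x) +
        confFactor x ^ 2 * (inner ℝ (B v) (gradV a x) + inner ℝ ν
          (((innerSL ℝ a ∘L A).smulRight x + inner ℝ x a • A
            - (innerSL ℝ x ∘L A).smulRight a) v)))
    (hm : ∀ v, m v = 2 * confFactor x ^ 3 * inner ℝ x (A v) * inner ℝ ν x +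
        confFactor x ^ 2 * (inner ℝ (B v) x + inner ℝ ν (A v))) :
    l (leftInv A x) = m (leftInv A (gradV a x)) := by
  have he := (confFactor_pos hx).ne'
  have hν2 : ‖ν‖ ^ 2 ≠ 0 := by positivity
  -- Split `w` into tangential and normal parts; `hB` evaluates the normal one, which will absorb
  -- the derivative of the conformal factor.
  have key : ∀ v w, inner ℝ (B v) w = inner ℝ (B v) (A (leftInv A w))
      - confFactor x * inner ℝ x (A v) * inner ℝ ν w := by
    intro v w
    rw [apply_leftInv hA hd hν hAν w, inner_sub_right, real_inner_smul_right,
      real_inner_comm ν (B v), hB]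
    field_simp
    ring
  -- Here the symmetry of the second fundamental form matches the two tangential terms.
  rw [hl, hm, key _ (gradV a x), key _ x, hsymm (leftInv A x)]
  simp only [sub_apply, add_apply,
    ContinuousLinearMap.smulRight_apply, smul_apply,
    ContinuousLinearMap.comp_apply, innerSL_apply_apply, inner_sub_right, inner_add_right,
    real_inner_smul_right, hAν]
  have h1 : inner ℝ x (A (leftInv A (gradV a x)))
      = (confFactor x)⁻¹ * inner ℝ a (A (leftInv A x)) +
        inner ℝ x a * inner ℝ x (A (leftInv A x)) := by
    rw [inner_apply_leftInv_comm hA, gradV_eq a hx, inner_add_left, real_inner_smul_left,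
      real_inner_smul_left]
  have h2 : inner ℝ ν (gradV a x) = (confFactor x)⁻¹ * inner ℝ ν a + inner ℝ x a * inner ℝ ν x := by
    rw [gradV_eq a hx, inner_add_right, real_inner_smul_right, real_inner_smul_right]
  rw [h1, h2]
  field_simp
  ring

theorem exists_hasFDerivAt_minkowskiField (hF : HasFDerivAt F A y) (hN : HasFDerivAt N B y)
    (hA : Function.Injective A) (hd : Module.finrank ℝ W = Module.finrank ℝ V + 1)
    (hx : ‖F y‖ < 1) (hν : N y ≠ 0) (hAν : ∀ v, inner ℝ (N y) (A v) = 0)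
    (hB : ∀ v, inner ℝ (N y) (B v) = -(confFactor (F y) * inner ℝ (F y) (A v) * ‖N y‖ ^ 2))
    (hsymm : ∀ v w, inner ℝ (B v) (A w) = inner ℝ (B w) (A v)) (R c : ℝ) (a : W) :
    ∃ Z' : V →L[ℝ] W, HasFDerivAt (fun z => minkowskiField R c a (F z) (N z)) Z' y ∧
      divAlong A Z' (F y) (minkowskiField R c a (F y) (N y)) =
        Module.finrank ℝ V * (weightV a (F y) + c * hypMetric (F y) (fieldY a (F y)) (N y)) -
          divAlong A B (F y) (N y) * hypMetric (F y) (fieldX R a (F y)) (N y) := by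
  -- The value of `k` is irrelevant: it enters the divergence only at the tangential part of `ν`,
  -- which is zero.
  obtain ⟨k, hk, -⟩ := exists_hasFDerivAt_hypMetric hF hx (hasFDerivAt_fieldX hF R a) hN
  obtain ⟨l, hl, hl'⟩ := exists_hasFDerivAt_hypMetric hF hx hN (hasFDerivAt_gradV hF a)
  obtain ⟨m, hm, hm'⟩ := exists_hasFDerivAt_hypMetric hF hx hN hF
  have hlm := rotation_terms_cancel hA hd a hx hν hAν hB hsymm hl' hm'
  set x := F y with hxdef
  set ν := N y with hνdef
  set P' := ((innerSL ℝ a ∘L A).smulRight x + inner ℝ x a • A - (innerSL ℝ x ∘L A).smulRight a)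
  refine ⟨(2 / (1 - euclRadius R ^ 2)) • P' +
      (-1 : ℝ) • (hypMetric x (fieldX R a x) ν • B + k.smulRight ν) +
      c • ((hypMetric x ν (gradV a x) • A + l.smulRight x) +
        (-1 : ℝ) • (hypMetric x ν x • P' + m.smulRight (gradV a x))), ?_, ?_⟩
  · have h := ((hasFDerivAt_fieldX hF R a).sub (hk.smul hN)).add
      (((hl.smul hF).sub (hm.smul (hasFDerivAt_gradV hF a))).const_smul c)
    refine h.congr_fderiv ?_
    rw [neg_one_smul, neg_one_smul, ← sub_eq_add_neg, ← sub_eq_add_neg]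
  · have h : minkowskiField R c a x ν = fieldX R a x + (-1 : ℝ) • (hypMetric x (fieldX R a x) ν • ν)
        + c • (hypMetric x ν (gradV a x) • x + (-1 : ℝ) • (hypMetric x ν x • gradV a x)) := by
      unfold minkowskiField
      module
    have hself : divAlong A A x x = Module.finrank ℝ V * (1 + confFactor x * ‖x‖ ^ 2) := by
      rw [divAlong, traceAlong_self hA, real_inner_self_eq_norm_sq]
      ring
    rw [h, divAlong_add, divAlong_add, divAlong_const_smul, divAlong_const_smul, divAlong_add,
      divAlong_const_smul, divAlong_smul, divAlong_smul, divAlong_smul, divAlong_fieldX hA R a hx,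
      divAlong_gradV hA a hx, hself, leftInv_eq_zero hAν, map_zero, hlm]
    -- Besides the matching V_a and mean curvature terms, what remains is Y_a = V_0 ∇V_a - V_a x,
    -- paired with `ν`.
    have he := confFactor_mul hx
    unfold hypMetric fieldY
    rw [weightV_eq, gradV_eq a hx]
    simp only [inner_sub_right, inner_add_right, real_inner_smul_right, real_inner_comm ν]
    have he0 := (confFactor_pos hx).ne'
    have hx2 : confFactor x * ‖x‖ ^ 2 = confFactor x - 2 := by linarith
    have hx3 : ‖x‖ ^ 2 = 1 - 2 * (confFactor x)⁻¹ := by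
      field_simp
      linarith
    rw [hx2, hx3]
    field_simp
    ring

theorem inner_minkowskiField (R c : ℝ) (a : W) {x ν : W} (h : hypMetric x ν ν = 1) :
    inner ℝ ν (minkowskiField R c a x ν) = 0 := by
  unfold minkowskiField hypMetric at *
  simp only [inner_sub_right, inner_add_right, real_inner_smul_right, real_inner_comm ν]
  linear_combination (-inner ℝ ν (fieldX R a x)) * h

end Fields

/-! ### The Riemannian density and the coordinate divergence -/

section Density

/-- Jacobi's formula. The determinant is multilinear in the rows, so its derivative is a sum of
determinants with one row replaced; Cramer's rule expresses these by the adjugate. -/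
theorem exists_hasFDerivAt_det {V : Type*} [NormedAddCommGroup V] [NormedSpace ℝ V] {m : ℕ}
    {G : V → Matrix (Fin m) (Fin m) ℝ} {G' : Fin m → Fin m → V →L[ℝ] ℝ} {y : V}
    (hG : ∀ i j, HasFDerivAt (fun z => G z i j) (G' i j) y) (h0 : (G y).det ≠ 0) :
    ∃ D : V →L[ℝ] ℝ, HasFDerivAt (fun z => (G z).det) D y ∧
      ∀ v, D v = (G y).det * Matrix.trace ((G y)⁻¹ * Matrix.of fun i j => G' i j v) := by
  let f : ContinuousMultilinearMap ℝ (fun _ : Fin m => Fin m → ℝ) ℝ :=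
    { (Matrix.detRowAlternating (R := ℝ) (n := Fin m)).toMultilinearMap with
      cont := (continuous_id (X := Matrix (Fin m) (Fin m) ℝ)).matrix_det }
  have hf : ∀ g : Fin m → Fin m → ℝ, f g = (Matrix.of g).det := fun g => rfl
  have hG2 : HasFDerivAt (fun z => (fun i j => G z i j : Fin m → Fin m → ℝ))
      (ContinuousLinearMap.pi fun i => ContinuousLinearMap.pi fun j => G' i j) y :=
    hasFDerivAt_pi.2 fun i => hasFDerivAt_pi.2 fun j => hG i j
  have hcomp := HasFDerivAt.comp (g := f) y (f.hasFDerivAt (fun i j => G y i j)) hG2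
  refine ⟨_, hcomp, fun v => ?_⟩
  rw [ContinuousLinearMap.comp_apply, ContinuousMultilinearMap.linearDeriv_apply]
  have h1 : (G y).det • (G y)⁻¹ = (G y).adjugate := by
    rw [Matrix.inv_def, smul_smul, Ring.mul_inverse_cancel _ h0.isUnit, one_smul]
  rw [← smul_eq_mul, ← Matrix.trace_smul, ← Matrix.smul_mul, h1, Matrix.trace_mul_comm,
    Matrix.trace]
  refine Finset.sum_congr rfl fun i _ => ?_
  rw [hf]
  have h2 := Matrix.cramer_transpose_apply (G y) (fun j => G' i j v) i
  rw [Matrix.cramer_eq_adjugate_mulVec, ← Matrix.adjugate_transpose] at h2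
  change ((G y).updateRow i (fun j => G' i j v)).det = _
  rw [← h2, Matrix.diag_apply, Matrix.mul_apply, Matrix.mulVec, dotProduct]
  refine Finset.sum_congr rfl fun j _ => ?_
  rw [Matrix.transpose_apply, Matrix.of_apply, mul_comm]

variable {n : ℕ} {W : Type*} [NormedAddCommGroup W] [InnerProductSpace ℝ W]
  [FiniteDimensional ℝ W]

/-- Jacobi's formula for the Gram matrix: each of the two factors `A` contributes the same trace,
the conformal factor contributes a multiple of the matrix itself, and the square root halves the
sum. -/
theorem exists_hasFDerivAt_sqrt_det {F : EuclideanSpace ℝ (Fin n) → W}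
    {A : EuclideanSpace ℝ (Fin n) → EuclideanSpace ℝ (Fin n) →L[ℝ] W}
    {A' : EuclideanSpace ℝ (Fin n) →L[ℝ] EuclideanSpace ℝ (Fin n) →L[ℝ] W}
    {y : EuclideanSpace ℝ (Fin n)} (hF : HasFDerivAt F (A y) y) (hA' : HasFDerivAt A A' y)
    (hA : Function.Injective (A y)) (hx : ‖F y‖ < 1) :
    ∃ D : EuclideanSpace ℝ (Fin n) →L[ℝ] ℝ,
      HasFDerivAt (fun z => Real.sqrt (pairMatrix (confFactor (F z)) (A z) (A z)).det) D y ∧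
      ∀ v, D v = Real.sqrt (pairMatrix (confFactor (F y)) (A y) (A y)).det *
        (traceAlong (A y) (A' v) + n * (confFactor (F y) * inner ℝ (F y) (A y v))) := by
  have he := (confFactor_pos hx).ne'
  have hpos := det_pairMatrix_self_pos he hA
  have h1 : ∀ i j : Fin n, ∃ l : EuclideanSpace ℝ (Fin n) →L[ℝ] ℝ,
      HasFDerivAt (fun z => pairMatrix (confFactor (F z)) (A z) (A z) i j) l y ∧
      ∀ v, l v = 2 * (confFactor (F y) * inner ℝ (F y) (A y v)) *
          pairMatrix (confFactor (F y)) (A y) (A y) i j +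
        (pairMatrix (confFactor (F y)) (A' v) (A y) i j +
          pairMatrix (confFactor (F y)) (A y) (A' v) i j) := by
    intro i j
    obtain ⟨l, hl, hl'⟩ := exists_hasFDerivAt_hypMetric hF hx
      (hA'.clm_apply (hasFDerivAt_const (EuclideanSpace.single i (1 : ℝ)) y))
      (hA'.clm_apply (hasFDerivAt_const (EuclideanSpace.single j (1 : ℝ)) y))
    refine ⟨l, hl, fun v => ?_⟩
    rw [hl']
    simp [pairMatrix]
    ring
  choose G' hG' hG'v using h1
  obtain ⟨D, hD, hDv⟩ := exists_hasFDerivAt_det hG' hpos.ne'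
  refine ⟨_, hD.sqrt hpos.ne', fun v => ?_⟩
  have h2 : (Matrix.of fun i j => G' i j v)
      = (2 * (confFactor (F y) * inner ℝ (F y) (A y v))) •
          pairMatrix (confFactor (F y)) (A y) (A y) +
        (pairMatrix (confFactor (F y)) (A' v) (A y) +
          pairMatrix (confFactor (F y)) (A y) (A' v)) := by
    ext i j
    simp [hG'v]
  rw [smul_apply, hDv, h2, Matrix.mul_add, Matrix.mul_add, Matrix.trace_add,
    Matrix.trace_add, Matrix.mul_smul, Matrix.trace_smul, trace_inv_mul_pairMatrix he hA,
    trace_inv_mul_pairMatrix he hA, trace_inv_mul_pairMatrix' he hA, traceAlong_self hA,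
    finrank_euclideanSpace_fin]
  have h3 := Real.sq_sqrt hpos.le
  have h4 := (Real.sqrt_pos.2 hpos).ne'
  simp only [smul_eq_mul]
  generalize Real.sqrt (pairMatrix (confFactor (F y)) (A y) (A y)).det = w at *
  rw [← h3]
  field_simp
  ring

/-- The coordinate expression of the divergence theorem: the Euclidean divergence of the density
times the coordinate vector field is the density times the hyperbolic divergence. -/
theorem exists_hasFDerivAt_density_smul {F Z : EuclideanSpace ℝ (Fin n) → W}
    {y : EuclideanSpace ℝ (Fin n)} {Z' : EuclideanSpace ℝ (Fin n) →L[ℝ] W}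
    {ρ : EuclideanSpace ℝ (Fin n) → ℝ} {ρ' : EuclideanSpace ℝ (Fin n) →L[ℝ] ℝ}
    (hF : ContDiffAt ℝ 2 F y) (hA : Function.Injective (fderiv ℝ F y)) (hx : ‖F y‖ < 1)
    (hZ : HasFDerivAt Z Z' y)
    (hZt : ∀ᶠ z in nhds y, fderiv ℝ F z (leftInv (fderiv ℝ F z) (Z z)) = Z z)
    (hρ : HasFDerivAt ρ ρ' y) :
    ∃ D : EuclideanSpace ℝ (Fin n) →L[ℝ] EuclideanSpace ℝ (Fin n),
      HasFDerivAt (fun z => (ρ z * Real.sqrt (pairMatrix (confFactor (F z)) (fderiv ℝ F z)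
        (fderiv ℝ F z)).det) • leftInv (fderiv ℝ F z) (Z z)) D y ∧
      LinearMap.trace ℝ (EuclideanSpace ℝ (Fin n)) (D : _ →ₗ[ℝ] _) =
        Real.sqrt (pairMatrix (confFactor (F y)) (fderiv ℝ F y) (fderiv ℝ F y)).det *
          (ρ y * divAlong (fderiv ℝ F y) Z' (F y) (Z y) +
            ρ' (leftInv (fderiv ℝ F y) (Z y))) := by
  have hF1 : HasFDerivAt F (fderiv ℝ F y) y :=
    (hF.differentiableAt (by norm_num)).hasFDerivAt
  have hA' : HasFDerivAt (fderiv ℝ F) (fderiv ℝ (fderiv ℝ F) y) y :=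
    ((hF.fderiv_right (m := 1) (by norm_num)).differentiableAt (by norm_num)).hasFDerivAt
  have hsymm : IsSymmSndFDerivAt ℝ F y := hF.isSymmSndFDerivAt (by simp)
  set A := fderiv ℝ F
  set A' := fderiv ℝ A y
  obtain ⟨E, hE, hEv⟩ := exists_hasFDerivAt_sqrt_det hF1 hA' hA hx
  have hL : DifferentiableAt ℝ (fun z => leftInv (A z)) y :=
    ((contDiffAt_leftInv hA).differentiableAt (by simp)).fun_comp' y hA'.differentiableAt
  have hT : HasFDerivAt (fun z => leftInv (A z) (Z z)) _ y := hL.hasFDerivAt.clm_apply hZ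
  set T : EuclideanSpace ℝ (Fin n) → EuclideanSpace ℝ (Fin n) := fun z => leftInv (A z) (Z z)
    with hTdef
  set T' := fderiv ℝ T y with hT'
  have hT2 : HasFDerivAt T T' y := hT.differentiableAt.hasFDerivAt
  have hAT : A y (T y) = Z y := hZt.self_of_nhds
  -- Differentiate the identity `A T = Z`, valid near `y` because `Z` is tangential.
  have h1 := (hZ.congr_of_eventuallyEq hZt).unique (hA'.clm_apply hT2)
  have h2 : T' = leftInv (A y) ∘L Z' - leftInv (A y) ∘L (A' (T y)) := by
    ext1 v
    have h3 := congrArg (fun l => leftInv (A y) (l v)) h1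
    simp only [add_apply, ContinuousLinearMap.comp_apply, ContinuousLinearMap.flip_apply, map_add,
      leftInv_apply hA] at h3
    -- By symmetry of the second derivative, the trace of T' contains -tr(A⁺ A'(T)), which the
    -- derivative of the density along `T` cancels.
    have h4 : A' v (T y) = A' (T y) v := hsymm v (T y)
    rw [h4] at h3
    simp [h3]
  refine ⟨_, (hρ.fun_mul hE).smul hT2, ?_⟩
  have h5 : LinearMap.trace ℝ _ (T' : EuclideanSpace ℝ (Fin n) →ₗ[ℝ] EuclideanSpace ℝ (Fin n))
      = traceAlong (A y) Z' - traceAlong (A y) (A' (T y)) := by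
    rw [h2, ContinuousLinearMap.toLinearMap_sub, map_sub]
    rfl
  have h6 : ∀ (r : ℝ) (l : EuclideanSpace ℝ (Fin n) →L[ℝ] ℝ), LinearMap.trace ℝ _
      ((r • T' + l.smulRight (T y) : _ →L[ℝ] _) :
        EuclideanSpace ℝ (Fin n) →ₗ[ℝ] EuclideanSpace ℝ (Fin n))
      = r * (traceAlong (A y) Z' - traceAlong (A y) (A' (T y))) + l (T y) := by
    intro r l
    rw [ContinuousLinearMap.toLinearMap_add, map_add, ContinuousLinearMap.toLinearMap_smul,
      map_smul, h5, smul_eq_mul]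
    congr 1
    exact LinearMap.trace_smulRight (l : _ →ₗ[ℝ] ℝ) (T y)
  have hTy : leftInv (A y) (Z y) = T y := rfl
  rw [h6, add_apply, smul_apply, smul_apply, hEv, hAT, hTy, divAlong, finrank_euclideanSpace_fin]
  simp only [smul_eq_mul]
  ring

/-- The mean curvature as a divergence of the unit normal field. -/
theorem trace_inv_mul_secondForm {A B : EuclideanSpace ℝ (Fin n) →L[ℝ] W}
    (hA : Function.Injective A) {x ν : W} (hx : ‖x‖ < 1) (hAν : ∀ v, inner ℝ ν (A v) = 0) :
    Matrix.trace ((pairMatrix (confFactor x) A A)⁻¹ * Matrix.of fun i j =>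
      hypMetric x (B (EuclideanSpace.single i 1) +
        christoffel x (A (EuclideanSpace.single i 1)) ν) (A (EuclideanSpace.single j 1)))
      = divAlong A B x ν := by
  -- Since `ν` is normal, two Christoffel terms drop out and the third is a multiple of `A`.
  have h1 : (Matrix.of fun i j => hypMetric x (B (EuclideanSpace.single i 1) +
        christoffel x (A (EuclideanSpace.single i 1)) ν) (A (EuclideanSpace.single j 1)))
      = pairMatrix (confFactor x) (B + (confFactor x * inner ℝ x ν) • A) A := by
    ext i j
    simp only [Matrix.of_apply, hypMetric, christoffel, pairMatrix, add_apply, smul_apply,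
      inner_add_left, inner_sub_left, real_inner_smul_left, hAν,
      real_inner_comm ν (A (EuclideanSpace.single i 1))]
    ring
  rw [h1, trace_inv_mul_pairMatrix (confFactor_pos hx).ne' hA, traceAlong_add, traceAlong_smul,
    traceAlong_self hA, divAlong]
  ring

end Density

/-! ### The divergence formula at interior points -/

section Interior

variable {n : ℕ} {W : Type*} [NormedAddCommGroup W] [InnerProductSpace ℝ W]
  [FiniteDimensional ℝ W]

theorem exists_hasFDerivAt_density_smul_minkowskiField
    {F N : EuclideanSpace ℝ (Fin n) → W} {y : EuclideanSpace ℝ (Fin n)}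
    {ρ : EuclideanSpace ℝ (Fin n) → ℝ} (hd : Module.finrank ℝ W = n + 1)
    (hF : ContDiffAt ℝ 2 F y) (hN : DifferentiableAt ℝ N y) (hρ : DifferentiableAt ℝ ρ y)
    (h : ∀ᶠ z in nhds y, Function.Injective (fderiv ℝ F z) ∧ ‖F z‖ < 1 ∧
      hypMetric (F z) (N z) (N z) = 1 ∧ ∀ v, inner ℝ (N z) (fderiv ℝ F z v) = 0)
    (R c : ℝ) (a : W) :
    ∃ D : EuclideanSpace ℝ (Fin n) →L[ℝ] EuclideanSpace ℝ (Fin n),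
      HasFDerivAt (fun z => (ρ z * Real.sqrt (pairMatrix (confFactor (F z)) (fderiv ℝ F z)
        (fderiv ℝ F z)).det) • leftInv (fderiv ℝ F z) (minkowskiField R c a (F z) (N z))) D y ∧
      LinearMap.trace ℝ (EuclideanSpace ℝ (Fin n)) (D : _ →ₗ[ℝ] _) =
        Real.sqrt (pairMatrix (confFactor (F y)) (fderiv ℝ F y) (fderiv ℝ F y)).det *
          (ρ y * (n * (weightV a (F y) + c * hypMetric (F y) (fieldY a (F y)) (N y)) -
            divAlong (fderiv ℝ F y) (fderiv ℝ N y) (F y) (N y) *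
              hypMetric (F y) (fieldX R a (F y)) (N y)) +
            fderiv ℝ ρ y (leftInv (fderiv ℝ F y) (minkowskiField R c a (F y) (N y)))) := by
  obtain ⟨hA, hx, hu, hAν⟩ := h.self_of_nhds
  have hF1 : HasFDerivAt F (fderiv ℝ F y) y :=
    (hF.differentiableAt (by norm_num)).hasFDerivAt
  have hA' : HasFDerivAt (fderiv ℝ F) (fderiv ℝ (fderiv ℝ F) y) y :=
    ((hF.fderiv_right (m := 1) (by norm_num)).differentiableAt (by norm_num)).hasFDerivAt
  have hd' : Module.finrank ℝ W = Module.finrank ℝ (EuclideanSpace ℝ (Fin n)) + 1 := by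
    rw [hd, finrank_euclideanSpace_fin]
  have hne : ∀ {x ν : W}, hypMetric x ν ν = 1 → ν ≠ 0 := by
    rintro x _ h rfl
    simp [hypMetric] at h
  -- Differentiate ḡ(ν, ν) = 1; the conformal factor gives the right-hand side.
  have hB : ∀ v, inner ℝ (N y) (fderiv ℝ N y v)
      = -(confFactor (F y) * inner ℝ (F y) (fderiv ℝ F y v) * ‖N y‖ ^ 2) := by
    intro v
    obtain ⟨l, hl, hl'⟩ := exists_hasFDerivAt_hypMetric hF1 hx hN.hasFDerivAt hN.hasFDerivAt
    have h1 : (fun z => hypMetric (F z) (N z) (N z)) =ᶠ[nhds y] fun _ => 1 :=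
      h.mono fun z hz => hz.2.2.1
    have h2 := hl.unique ((hasFDerivAt_const (1 : ℝ) y).congr_of_eventuallyEq h1)
    have h3 := hl' v
    rw [h2, real_inner_comm (N y) (fderiv ℝ N y v), real_inner_self_eq_norm_sq] at h3
    have he := confFactor_pos hx
    have h4 : confFactor (F y) ^ 2 * (confFactor (F y) * inner ℝ (F y) (fderiv ℝ F y v) *
      ‖N y‖ ^ 2 + inner ℝ (N y) (fderiv ℝ N y v)) = 0 := by
      simp only [zero_apply] at h3
      linarith
    have h5 := (mul_eq_zero.1 h4).resolve_left (by positivity)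
    linarith
  -- Differentiate ⟨ν, dF(w)⟩ = 0 and use the symmetry of the second derivative of `F`.
  have hsymm : ∀ v w, inner ℝ (fderiv ℝ N y v) (fderiv ℝ F y w)
      = inner ℝ (fderiv ℝ N y w) (fderiv ℝ F y v) := by
    have h1 : ∀ v w, inner ℝ (fderiv ℝ N y v) (fderiv ℝ F y w)
        = -inner ℝ (N y) (fderiv ℝ (fderiv ℝ F) y v w) := by
      intro v w
      have h2 := hN.hasFDerivAt.inner ℝ (hA'.clm_apply (hasFDerivAt_const w y))
      have h3 : (fun z => inner ℝ (N z) (fderiv ℝ F z w)) =ᶠ[nhds y] fun _ => 0 :=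
        h.mono fun z hz => hz.2.2.2 w
      have h4 := congrArg (fun l => l v)
        (h2.unique ((hasFDerivAt_const (0 : ℝ) y).congr_of_eventuallyEq h3))
      simp [fderivInnerCLM_apply] at h4
      linarith
    have h2 : IsSymmSndFDerivAt ℝ F y := hF.isSymmSndFDerivAt (by simp)
    intro v w
    rw [h1, h1, h2 v w]
  obtain ⟨Z', hZ, hZ'⟩ := exists_hasFDerivAt_minkowskiField hF1 hN.hasFDerivAt hA hd' hx (hne hu)
    hAν hB hsymm R c a
  rw [finrank_euclideanSpace_fin] at hZ'
  rw [← hZ']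
  refine exists_hasFDerivAt_density_smul hF hA hx hZ (h.mono fun z hz => ?_) hρ.hasFDerivAt
  rw [apply_leftInv hz.1 hd' (hne hz.2.2.1) hz.2.2.2, inner_minkowskiField R c a hz.2.2.1,
    zero_div, zero_smul, sub_zero]

end Interior

/-! ### The divergence theorem on a half space -/

section HalfSpace

theorem trace_eq_sum_single {n : ℕ} (D : EuclideanSpace ℝ (Fin n) →L[ℝ] EuclideanSpace ℝ (Fin n)) :
    LinearMap.trace ℝ (EuclideanSpace ℝ (Fin n)) (D : _ →ₗ[ℝ] _)
      = ∑ i, D (EuclideanSpace.single i 1) i := by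
  rw [LinearMap.trace_eq_matrix_trace ℝ (EuclideanSpace.basisFun (Fin n) ℝ).toBasis, Matrix.trace]
  refine Finset.sum_congr rfl fun i _ => ?_
  rw [Matrix.diag_apply, LinearMap.toMatrix_apply]
  simp

/-- The divergence theorem on a half space, for a compactly supported field which is tangent to the
boundary. -/
theorem integral_halfSpace_trace_eq_zero {n : ℕ} [NeZero n]
    {f : EuclideanSpace ℝ (Fin n) → EuclideanSpace ℝ (Fin n)}
    {D : EuclideanSpace ℝ (Fin n) → EuclideanSpace ℝ (Fin n) →L[ℝ] EuclideanSpace ℝ (Fin n)}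
    {d : EuclideanSpace ℝ (Fin n) → ℝ} {K : Set (EuclideanSpace ℝ (Fin n))}
    (hK : Bornology.IsBounded K)
    (hf : ContinuousOn f {y | 0 ≤ y 0}) (hd : ContinuousOn d {y | 0 ≤ y 0})
    (hfK : ∀ y, y ∉ K → f y = 0) (hdK : ∀ y, y ∉ K → d y = 0)
    (h0 : ∀ y : EuclideanSpace ℝ (Fin n), y 0 = 0 → f y 0 = 0)
    (hD : ∀ y : EuclideanSpace ℝ (Fin n), 0 < y 0 → HasFDerivAt f (D y) y ∧
      LinearMap.trace ℝ (EuclideanSpace ℝ (Fin n)) (D y : _ →ₗ[ℝ] _) = d y) :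
    ∫ y in {y : EuclideanSpace ℝ (Fin n) | 0 ≤ y 0}, d y = 0 := by
  obtain ⟨m, rfl⟩ := Nat.exists_eq_succ_of_ne_zero (NeZero.ne n)
  obtain ⟨r, hr0, hr⟩ := hK.subset_ball_lt 0 0
  have hcoord : ∀ y ∈ K, ∀ i, |y i| < r := by
    intro y hy i
    have h1 : ‖y i‖ ≤ ‖y‖ := PiLp.norm_apply_le y i
    have h2 := hr hy
    rw [mem_ball_zero_iff] at h2
    exact h1.trans_lt h2
  let e : EuclideanSpace ℝ (Fin (m + 1)) ≃L[ℝ] (Fin (m + 1) → ℝ) := EuclideanSpace.equiv _ ℝ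
  have hesymm : ∀ x i, (e.symm x) i = x i := fun x i => rfl
  have he : ∀ x i, e x i = x i := fun x i => rfl
  -- The box [0, r] × [-r, r]^m contains the part of `K` in the half space, and only its face y₀ = 0
  -- can meet `K`.
  let a : Fin (m + 1) → ℝ := fun i => if i = 0 then 0 else -r
  let b : Fin (m + 1) → ℝ := fun _ => r
  have hab : a ≤ b := by
    intro i
    by_cases hi : i = 0 <;> simp [a, b, hi, hr0.le]
  have hsub : ∀ x ∈ Set.Icc a b, 0 ≤ (e.symm x) 0 := by
    intro x hx
    have := hx.1 0
    simpa [a, hesymm] using this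
  have hint : ∀ x ∈ (Set.pi Set.univ fun i => Set.Ioo (a i) (b i)), 0 < (e.symm x) 0 := by
    intro x hx
    have := (hx 0 (Set.mem_univ _)).1
    simpa [a, hesymm] using this
  let f' : (Fin (m + 1) → ℝ) → (Fin (m + 1) → ℝ) →L[ℝ] (Fin (m + 1) → ℝ) := fun x =>
    (e : EuclideanSpace ℝ (Fin (m + 1)) →L[ℝ] (Fin (m + 1) → ℝ)) ∘L D (e.symm x) ∘L
      (e.symm : (Fin (m + 1) → ℝ) →L[ℝ] EuclideanSpace ℝ (Fin (m + 1)))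
  have hsum : ∀ x, ∑ i, f' x (Pi.single i 1) i
      = LinearMap.trace ℝ (EuclideanSpace ℝ (Fin (m + 1))) (D (e.symm x) : _ →ₗ[ℝ] _) := by
    intro x
    rw [trace_eq_sum_single]
    rfl
  have hcd : ContinuousOn (fun x => d (e.symm x)) (Set.Icc a b) :=
    hd.comp e.symm.continuous.continuousOn hsub
  -- The trace is known only for y₀ > 0; this suffices because the boundary of the box is a null
  -- set.
  have hae : ∀ᵐ x ∂(volume.restrict (Set.Icc a b)),
      ∑ i, f' x (Pi.single i 1) i = d (e.symm x) := by
    have h1 : (volume.restrict (Set.Icc a b) : Measure (Fin (m + 1) → ℝ))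
        = volume.restrict (Set.pi Set.univ fun i => Set.Ioo (a i) (b i)) :=
      Measure.restrict_congr_set Measure.univ_pi_Ioo_ae_eq_Icc.symm
    rw [h1]
    refine (ae_restrict_iff' (MeasurableSet.univ_pi fun i => measurableSet_Ioo)).2
      (Filter.Eventually.of_forall fun x hx => ?_)
    rw [hsum, (hD _ (hint x hx)).2]
  have hdiv := integral_divergence_of_hasFDerivAt_off_countable a b hab
    (fun x => e (f (e.symm x))) f' ∅ Set.countable_empty
    (e.continuous.comp_continuousOn (hf.comp e.symm.continuous.continuousOn hsub))
    (fun x hx => by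
      have h1 := (hD _ (hint x hx.1)).1
      exact e.hasFDerivAt.comp x (h1.comp x e.symm.hasFDerivAt))
    (((hcd.integrableOn_compact isCompact_Icc).congr (hae.mono fun x hx => hx.symm)))
  rw [integral_congr_ae hae] at hdiv
  have hface : ∀ x : Fin (m + 1) → ℝ, ∀ i, (x i = r ∨ x i = -r) → f (e.symm x) = 0 := by
    intro x i hx
    refine hfK _ fun hk => ?_
    have h1 := hcoord _ hk i
    rw [hesymm] at h1
    rcases hx with hx | hx <;> rw [hx] at h1
    · exact absurd (le_abs_self r) (not_le.2 h1)
    · rw [abs_neg] at h1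
      exact absurd (le_abs_self r) (not_le.2 h1)
  have hzero : ∫ x in Set.Icc a b, d (e.symm x) = 0 := by
    rw [hdiv]
    refine Finset.sum_eq_zero fun i _ => ?_
    have h1 : ∀ x : Fin m → ℝ, e (f (e.symm (i.insertNth (b i) x))) i = 0 := by
      intro x
      rw [hface _ i (Or.inl (by simp [b]))]
      simp
    have h2 : ∀ x : Fin m → ℝ, e (f (e.symm (i.insertNth (a i) x))) i = 0 := by
      intro x
      -- On the face y₀ = 0 only the normal component of `f` vanishes, by `h0`; on every other face
      -- `f` itself does.
      by_cases hi : i = 0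
      · subst hi
        rw [he]
        refine h0 _ ?_
        change (Fin.insertNth (α := fun _ => ℝ) 0 (a 0) x) 0 = 0
        simp [a]
      · rw [hface _ i (Or.inr (by simp [a, hi]))]
        simp
    simp only [h1, h2, integral_zero, sub_zero]
  have hvol := (EuclideanSpace.volume_preserving_symm_measurableEquiv_toLp (Fin (m + 1))).symm
  have hpre := hvol.setIntegral_preimage_emb (MeasurableEquiv.measurableEmbedding _) d
    {y : EuclideanSpace ℝ (Fin (m + 1)) | 0 ≤ y 0}
  rw [← hpre]
  refine Eq.trans ?_ hzero
  refine (setIntegral_eq_of_subset_of_forall_sdiff_eq_zero ?_ (fun x hx => hsub x hx) ?_)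
  · exact measurableSet_le (f := fun _ : Fin (m + 1) → ℝ => (0 : ℝ)) measurable_const
      (measurable_pi_apply (0 : Fin (m + 1)))
  · rintro x ⟨hx1, hx2⟩
    refine hdK _ fun hk => hx2 ⟨fun i => ?_, fun i => ?_⟩
    · by_cases hi : i = 0
      · subst hi
        simpa [a] using hx1
      · simp only [a, hi, if_false]
        exact (abs_lt.1 (hcoord _ hk i)).1.le
    · exact (abs_lt.1 (hcoord _ hk i)).2.le

end HalfSpace

/-! ### Differentials in charts of a manifold with boundary -/

section Charts

variable {n : ℕ} [NeZero n] {M : Type*} [TopologicalSpace M]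
  [ChartedSpace (EuclideanHalfSpace n) M]
  {G : Type*} [NormedAddCommGroup G] [NormedSpace ℝ G]

/-- The differential of a vector-valued function, as a linear map on the model space. -/
def diffCLM (f : M → G) (p : M) : EuclideanSpace ℝ (Fin n) →L[ℝ] G :=
  mfderiv (𝓡∂ n) 𝓘(ℝ, G) f p

/-- The derivative of a function in the coordinates of the preferred chart at `c`. -/
def chartDeriv (f : M → G) (c : M) (y : EuclideanSpace ℝ (Fin n)) :
    EuclideanSpace ℝ (Fin n) →L[ℝ] G :=
  fderivWithin ℝ (f ∘ (extChartAt (𝓡∂ n) c).symm) (Set.range (𝓡∂ n)) y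

/-- The differential of the inverse of the preferred chart at `c`. -/
def chartFrame (c : M) (y : EuclideanSpace ℝ (Fin n)) :
    EuclideanSpace ℝ (Fin n) →L[ℝ] EuclideanSpace ℝ (Fin n) :=
  mfderivWithin 𝓘(ℝ, EuclideanSpace ℝ (Fin n)) (𝓡∂ n) (extChartAt (𝓡∂ n) c).symm
    (Set.range (𝓡∂ n)) y

theorem diffCLM_eq_fderivWithin {f : M → G} {p : M}
    (hf : MDifferentiableAt (𝓡∂ n) 𝓘(ℝ, G) f p) :
    diffCLM f p = fderivWithin ℝ (f ∘ (extChartAt (𝓡∂ n) p).symm) (Set.range (𝓡∂ n))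
      (extChartAt (𝓡∂ n) p p) := by
  have h : HasFDerivWithinAt (f ∘ (extChartAt (𝓡∂ n) p).symm) (diffCLM f p)
    (Set.range (𝓡∂ n)) (extChartAt (𝓡∂ n) p p) := hf.hasMFDerivAt.2
  exact (h.fderivWithin ((𝓡∂ n).uniqueDiffOn _ (Set.mem_range_self _))).symm

theorem diffCLM_sum {ι : Type*} (s : Finset ι) {f : ι → M → G} {p : M}
    (hf : ∀ i ∈ s, MDifferentiableAt (𝓡∂ n) 𝓘(ℝ, G) (f i) p)
    (hs : MDifferentiableAt (𝓡∂ n) 𝓘(ℝ, G) (fun q => ∑ i ∈ s, f i q) p) :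
    diffCLM (n := n) (fun q => ∑ i ∈ s, f i q) p = ∑ i ∈ s, diffCLM (n := n) (f i) p := by
  rw [diffCLM_eq_fderivWithin hs]
  have hu : UniqueDiffWithinAt ℝ (Set.range (𝓡∂ n)) (extChartAt (𝓡∂ n) p p) :=
    (𝓡∂ n).uniqueDiffOn _ (Set.mem_range_self _)
  have h1 := fderivWithin_fun_sum (u := s)
    (A := fun i => (f i) ∘ (extChartAt (𝓡∂ n) p).symm) hu
    (fun i hi => (mdifferentiableAt_iff _ _).1 (hf i hi) |>.2)
  refine h1.trans (Finset.sum_congr rfl fun i hi => ?_)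
  rw [diffCLM_eq_fderivWithin (hf i hi)]

theorem diffCLM_eq_zero_of_eventuallyEq {f : M → G} {p : M} {c : G}
    (hf : f =ᶠ[nhds p] fun _ => c) : diffCLM (n := n) f p = 0 := by
  unfold diffCLM
  rw [hf.mfderiv_eq]
  exact mfderiv_const

variable [IsManifold (𝓡∂ n) ∞ M]

theorem isManifold_one : IsManifold (𝓡∂ n) 1 M :=
  IsManifold.of_le (n := ∞) (by simp)

theorem exists_equiv_chartFrame {c : M} {y : EuclideanSpace ℝ (Fin n)}
    (hy : y ∈ (extChartAt (𝓡∂ n) c).target) :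
    ∃ L : EuclideanSpace ℝ (Fin n) ≃L[ℝ] EuclideanSpace ℝ (Fin n),
      (L : EuclideanSpace ℝ (Fin n) →L[ℝ] EuclideanSpace ℝ (Fin n)) = chartFrame c y := by
  have : IsManifold (𝓡∂ n) 1 M := isManifold_one
  exact isInvertible_mfderivWithin_extChartAt_symm hy

theorem hasFDerivWithinAt_comp_extChartAt_symm {f : M → G} {c : M} {y : EuclideanSpace ℝ (Fin n)}
    (hy : y ∈ (extChartAt (𝓡∂ n) c).target)
    (hf : MDifferentiableAt (𝓡∂ n) 𝓘(ℝ, G) f ((extChartAt (𝓡∂ n) c).symm y)) :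
    HasFDerivWithinAt (f ∘ (extChartAt (𝓡∂ n) c).symm)
      (diffCLM f ((extChartAt (𝓡∂ n) c).symm y) ∘L chartFrame c y) (Set.range (𝓡∂ n)) y := by
  have : IsManifold (𝓡∂ n) 1 M := isManifold_one
  have h1 := (mdifferentiableWithinAt_extChartAt_symm (I := 𝓡∂ n) hy).hasMFDerivWithinAt
  have h2 := hf.hasMFDerivAt.comp_hasMFDerivWithinAt y h1
  exact h2.hasFDerivWithinAt

theorem chartDeriv_eq {f : M → G} {c : M} {y : EuclideanSpace ℝ (Fin n)}
    (hy : y ∈ (extChartAt (𝓡∂ n) c).target)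
    (hf : MDifferentiableAt (𝓡∂ n) 𝓘(ℝ, G) f ((extChartAt (𝓡∂ n) c).symm y)) :
    chartDeriv f c y = diffCLM f ((extChartAt (𝓡∂ n) c).symm y) ∘L chartFrame c y :=
  (hasFDerivWithinAt_comp_extChartAt_symm hy hf).fderivWithin
    ((𝓡∂ n).uniqueDiffOn _ (extChartAt_target_subset_range c hy))

theorem chartFrame_comp_diffCLM_extChartAt {c : M} {y : EuclideanSpace ℝ (Fin n)}
    (hy : y ∈ (extChartAt (𝓡∂ n) c).target) :
    chartFrame c y ∘L diffCLM (extChartAt (𝓡∂ n) c) ((extChartAt (𝓡∂ n) c).symm y)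
      = ContinuousLinearMap.id ℝ (EuclideanSpace ℝ (Fin n)) := by
  have : IsManifold (𝓡∂ n) 1 M := isManifold_one
  exact mfderivWithin_extChartAt_symm_comp_mfderiv_extChartAt hy

theorem chart_target_mem_nhdsWithin {c : M} {y : EuclideanSpace ℝ (Fin n)}
    (hy : y ∈ (extChartAt (𝓡∂ n) c).target) :
    (extChartAt (𝓡∂ n) c).target ∈ nhdsWithin y (Set.range (𝓡∂ n)) :=
  extChartAt_target_mem_nhdsWithin_of_mem hy

theorem contDiffOn_comp_extChartAt_symm {f : M → G} (hf : ContMDiff (𝓡∂ n) 𝓘(ℝ, G) ∞ f) (c : M) :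
    ContDiffOn ℝ ∞ (f ∘ (extChartAt (𝓡∂ n) c).symm) (extChartAt (𝓡∂ n) c).target := by
  rw [← contMDiffOn_iff_contDiffOn]
  exact hf.comp_contMDiffOn (contMDiffOn_extChartAt_symm c)

/-- The target is relatively open in the half space, so both sets define the same derivative.
Smoothness is available on the target, while `chartDeriv` differentiates within the half space. -/
theorem chartDeriv_eq_fderivWithin_target (f : M → G) {c : M} {y : EuclideanSpace ℝ (Fin n)}
    (hy : y ∈ (extChartAt (𝓡∂ n) c).target) :
    chartDeriv f c y
      = fderivWithin ℝ (f ∘ (extChartAt (𝓡∂ n) c).symm) (extChartAt (𝓡∂ n) c).target y := by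
  have h1 : nhdsWithin y (extChartAt (𝓡∂ n) c).target = nhdsWithin y (Set.range (𝓡∂ n)) :=
    le_antisymm (nhdsWithin_mono _ (extChartAt_target_subset_range c))
      (nhdsWithin_le_of_mem (chart_target_mem_nhdsWithin hy))
  unfold chartDeriv
  exact (fderivWithin_congr_set (nhdsWithin_eq_iff_eventuallyEq.1 h1)).symm

theorem continuousOn_chartDeriv {f : M → G} (hf : ContMDiff (𝓡∂ n) 𝓘(ℝ, G) ∞ f) (c : M) :
    ContinuousOn (chartDeriv f c) (extChartAt (𝓡∂ n) c).target := by
  refine ContinuousOn.congr ?_ fun y hy => chartDeriv_eq_fderivWithin_target f hy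
  exact (contDiffOn_comp_extChartAt_symm hf c).continuousOn_fderivWithin
    (uniqueDiffOn_extChartAt_target c) (by simp)

theorem measurableSet_extChartAt_target (c : M) :
    MeasurableSet (extChartAt (𝓡∂ n) c).target := by
  rw [extChartAt_target]
  exact ((chartAt _ c).open_target.preimage (𝓡∂ n).continuous_symm).measurableSet.inter
    (𝓡∂ n).isClosed_range.measurableSet

end Charts

/-! ### The area measure -/

section Area

variable {n : ℕ} [NeZero n] {M : Type*} [TopologicalSpace M]
  [ChartedSpace (EuclideanHalfSpace n) M]

theorem coordGram_eq (x : M → EuclideanSpace ℝ (Fin (n + 1))) (c : M)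
    (y : EuclideanSpace ℝ (Fin n)) :
    coordGram x c y = pairMatrix (confFactor (x ((extChartAt (𝓡∂ n) c).symm y)))
      (chartDeriv x c y) (chartDeriv x c y) :=
  rfl

/-- The density `√(det g)` in the coordinates of the preferred chart at `c`. -/
def density (x : M → EuclideanSpace ℝ (Fin (n + 1))) (c : M) (y : EuclideanSpace ℝ (Fin n)) : ℝ :=
  Real.sqrt (coordGram x c y).det

theorem continuous_confFactor {x : M → EuclideanSpace ℝ (Fin (n + 1))}
    (hx : Continuous x) (h1 : ∀ p, ‖x p‖ < 1) : Continuous fun p => confFactor (x p) := by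
  unfold confFactor
  refine continuous_const.div (continuous_const.sub (hx.norm.pow 2)) fun p => ?_
  nlinarith [norm_nonneg (x p), h1 p]

variable [IsManifold (𝓡∂ n) ∞ M]

theorem continuousOn_density {x : M → EuclideanSpace ℝ (Fin (n + 1))}
    (hx : ContMDiff (𝓡∂ n) (𝓡 (n + 1)) ∞ x) (h1 : ∀ p, ‖x p‖ < 1) (c : M) :
    ContinuousOn (density x c) (extChartAt (𝓡∂ n) c).target := by
  have hA := continuousOn_chartDeriv hx c
  have he : ContinuousOn (fun y => confFactor (x ((extChartAt (𝓡∂ n) c).symm y)))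
      (extChartAt (𝓡∂ n) c).target :=
    (continuous_confFactor hx.continuous h1).comp_continuousOn (continuousOn_extChartAt_symm c)
  have hG : ContinuousOn (fun y => coordGram x c y) (extChartAt (𝓡∂ n) c).target := by
    refine continuousOn_pi.2 fun i => continuousOn_pi.2 fun j => ?_
    exact (he.pow 2).mul ((hA.clm_apply continuousOn_const).inner
      (hA.clm_apply continuousOn_const))
  have hdet : Continuous fun G : Matrix (Fin n) (Fin n) ℝ => G.det := continuous_id.matrix_det
  exact Real.continuous_sqrt.comp_continuousOn (hdet.comp_continuousOn hG)

/-- The transformation rule of the density under a change of charts. -/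
theorem exists_density_eq {x : M → EuclideanSpace ℝ (Fin (n + 1))}
    (hx : ContMDiff (𝓡∂ n) (𝓡 (n + 1)) ∞ x) (c q : M) {y : EuclideanSpace ℝ (Fin n)}
    (hy : y ∈ (extChartAt (𝓡∂ n) q).target)
    (hyc : (extChartAt (𝓡∂ n) q).symm y ∈ (extChartAt (𝓡∂ n) c).source) :
    ∃ τ' : EuclideanSpace ℝ (Fin n) →L[ℝ] EuclideanSpace ℝ (Fin n),
      HasFDerivWithinAt (extChartAt (𝓡∂ n) c ∘ (extChartAt (𝓡∂ n) q).symm) τ'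
        (Set.range (𝓡∂ n)) y ∧
      density x q y = |τ'.det| * density x c (extChartAt (𝓡∂ n) c ((extChartAt (𝓡∂ n) q).symm y)) := by
  have : IsManifold (𝓡∂ n) 1 M := isManifold_one
  set p := (extChartAt (𝓡∂ n) q).symm y with hp
  set z := extChartAt (𝓡∂ n) c p with hz
  have hzt : z ∈ (extChartAt (𝓡∂ n) c).target := (extChartAt (𝓡∂ n) c).map_source hyc
  have hzp : (extChartAt (𝓡∂ n) c).symm z = p := (extChartAt (𝓡∂ n) c).left_inv hyc
  have hxp : MDifferentiableAt (𝓡∂ n) (𝓡 (n + 1)) x p := hx.mdifferentiableAt (by simp)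
  have hc : MDifferentiableAt (𝓡∂ n) 𝓘(ℝ, EuclideanSpace ℝ (Fin n)) (extChartAt (𝓡∂ n) c) p :=
    mdifferentiableAt_extChartAt (by rwa [← extChartAt_source (𝓡∂ n)])
  refine ⟨_, hasFDerivWithinAt_comp_extChartAt_symm hy hc, ?_⟩
  have h1 := chartFrame_comp_diffCLM_extChartAt hzt
  have h2 := chartDeriv_eq hy hxp
  have h3 := chartDeriv_eq (f := x) hzt (by rw [hzp]; exact hxp)
  rw [hzp] at h1 h3
  have h4 : chartDeriv x q y = chartDeriv x c z ∘L
      (diffCLM (extChartAt (𝓡∂ n) c) p ∘L chartFrame q y) := by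
    rw [h2, h3, ContinuousLinearMap.comp_assoc, ← ContinuousLinearMap.comp_assoc (chartFrame c z),
      h1, ContinuousLinearMap.id_comp]
  rw [density, density, coordGram_eq, coordGram_eq, h4, pairMatrix_comp_self, hzp,
    Real.sqrt_mul (sq_nonneg _), Real.sqrt_sq_eq_abs]

variable [MeasurableSpace M] [BorelSpace M]

theorem measurableSet_preimage_inter_target (c : M) {s : Set M} (hs : MeasurableSet s) :
    MeasurableSet ((extChartAt (𝓡∂ n) c).symm ⁻¹' s ∩ (extChartAt (𝓡∂ n) c).target) := by
  have h1 := (continuousOn_iff_continuous_domRestrict.1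
    (continuousOn_extChartAt_symm (I := 𝓡∂ n) c)).measurable hs
  have h2 := (measurableSet_extChartAt_target c).subtype_image h1
  rwa [Set.domRestrict_eq, Set.preimage_comp, Subtype.image_preimage_coe, Set.inter_comm] at h2

theorem aemeasurable_extChartAt_symm (x : M → EuclideanSpace ℝ (Fin (n + 1))) (c : M) :
    AEMeasurable (extChartAt (𝓡∂ n) c).symm
      ((((volume : Measure (EuclideanSpace ℝ (Fin n))).restrict
        (extChartAt (𝓡∂ n) c).target).withDensity
          fun y => ENNReal.ofReal (Real.sqrt (coordGram x c y).det))) :=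
  ((continuousOn_extChartAt_symm c).aemeasurable (measurableSet_extChartAt_target c)).mono_ac
    (withDensity_absolutelyContinuous _ _)

theorem chartArea_apply (x : M → EuclideanSpace ℝ (Fin (n + 1))) (c : M) {s : Set M}
    (hs : MeasurableSet s) :
    chartArea x c s = ∫⁻ y in (extChartAt (𝓡∂ n) c).symm ⁻¹' s ∩ (extChartAt (𝓡∂ n) c).target,
      ENNReal.ofReal (density x c y) := by
  rw [chartArea, Measure.map_apply_of_aemeasurable (aemeasurable_extChartAt_symm x c) hs,
    withDensity_apply', Measure.restrict_restrict' (measurableSet_extChartAt_target c)]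
  rfl

theorem measurableSet_extChartAt_source (c : M) : MeasurableSet (extChartAt (𝓡∂ n) c).source :=
  (isOpen_extChartAt_source c).measurableSet

/-- Change of variables along the transition map, whose Jacobian is the ratio of the densities. An
inequality is enough, since the area is a supremum. -/
theorem chartArea_restrict_le {x : M → EuclideanSpace ℝ (Fin (n + 1))}
    (hx : ContMDiff (𝓡∂ n) (𝓡 (n + 1)) ∞ x) (c q : M) :
    (chartArea x q).restrict (extChartAt (𝓡∂ n) c).source ≤ chartArea x c := by
  refine Measure.le_iff.2 fun s hs => ?_
  have hsc := hs.inter (measurableSet_extChartAt_source (n := n) c)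
  rw [Measure.restrict_apply hs, chartArea_apply x q hsc, chartArea_apply x c hs]
  set D := (extChartAt (𝓡∂ n) q).symm ⁻¹' (s ∩ (extChartAt (𝓡∂ n) c).source) ∩
    (extChartAt (𝓡∂ n) q).target with hD
  have hDm : MeasurableSet D := measurableSet_preimage_inter_target q hsc
  have h1 : ∀ y : EuclideanSpace ℝ (Fin n), ∃ τ' : EuclideanSpace ℝ (Fin n) →L[ℝ]
      EuclideanSpace ℝ (Fin n), y ∈ D →
      HasFDerivWithinAt (extChartAt (𝓡∂ n) c ∘ (extChartAt (𝓡∂ n) q).symm) τ' D y ∧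
      density x q y
        = |τ'.det| * density x c (extChartAt (𝓡∂ n) c ((extChartAt (𝓡∂ n) q).symm y)) := by
    intro y
    by_cases hy : y ∈ D
    · obtain ⟨τ', h1, h2⟩ := exists_density_eq hx c q hy.2 hy.1.2
      exact ⟨τ', fun _ => ⟨h1.mono fun z hz => extChartAt_target_subset_range q hz.2, h2⟩⟩
    · exact ⟨0, fun h => absurd h hy⟩
  choose τ' hτ using h1
  have hinj : Set.InjOn (extChartAt (𝓡∂ n) c ∘ (extChartAt (𝓡∂ n) q).symm) D := by
    intro y hy z hz hyz
    exact (extChartAt (𝓡∂ n) q).symm.injOn hy.2 hz.2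
      ((extChartAt (𝓡∂ n) c).injOn hy.1.2 hz.1.2 hyz)
  have h2 := lintegral_image_eq_lintegral_abs_det_fderiv_mul volume hDm
    (fun y hy => (hτ y hy).1) hinj (fun z => ENNReal.ofReal (density x c z))
  have h3 : ∫⁻ y in D, ENNReal.ofReal (density x q y)
      = ∫⁻ y in D, ENNReal.ofReal |(τ' y).det| * ENNReal.ofReal
        (density x c ((extChartAt (𝓡∂ n) c ∘ (extChartAt (𝓡∂ n) q).symm) y)) := by
    refine setLIntegral_congr_fun hDm fun y hy => ?_
    rw [← ENNReal.ofReal_mul (abs_nonneg _), (hτ y hy).2]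
    rfl
  rw [h3, ← h2]
  refine lintegral_mono_set ?_
  rintro _ ⟨y, hy, rfl⟩
  refine ⟨?_, (extChartAt (𝓡∂ n) c).map_source hy.1.2⟩
  change (extChartAt (𝓡∂ n) c).symm (extChartAt (𝓡∂ n) c ((extChartAt (𝓡∂ n) q).symm y)) ∈ s
  rw [(extChartAt (𝓡∂ n) c).left_inv hy.1.2]
  exact hy.1.1

theorem chartArea_restrict_source (x : M → EuclideanSpace ℝ (Fin (n + 1))) (c : M) :
    (chartArea x c).restrict (extChartAt (𝓡∂ n) c).source = chartArea x c := by
  refine Measure.restrict_eq_self_of_ae_mem ?_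
  rw [ae_iff]
  have hm : MeasurableSet {p | p ∉ (extChartAt (𝓡∂ n) c).source} :=
    (measurableSet_extChartAt_source c).compl
  rw [chartArea_apply x c hm]
  have : (extChartAt (𝓡∂ n) c).symm ⁻¹' {p | p ∉ (extChartAt (𝓡∂ n) c).source} ∩
      (extChartAt (𝓡∂ n) c).target = ∅ := by
    ext y
    simp only [Set.mem_inter_iff, Set.mem_preimage, Set.mem_ofPred_eq, Set.mem_empty_iff_false,
      iff_false, not_and]
    intro h hy
    exact h ((extChartAt (𝓡∂ n) c).map_target hy)
  rw [this]
  simp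

/-- The area measure restricts to the coordinate measure on each chart domain. -/
theorem area_restrict_source {x : M → EuclideanSpace ℝ (Fin (n + 1))}
    (hx : ContMDiff (𝓡∂ n) (𝓡 (n + 1)) ∞ x) (c : M) :
    (area x).restrict (extChartAt (𝓡∂ n) c).source = chartArea x c := by
  set S := (extChartAt (𝓡∂ n) c).source with hS
  have hSm : MeasurableSet S := measurableSet_extChartAt_source c
  refine le_antisymm ?_ ?_
  -- Outside the chart domain the crude bound by `⊤` is harmless: it disappears on restriction to
  -- `S`.
  · have h1 : area x ≤ chartArea x c + (⊤ : Measure M).restrict Sᶜ := by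
      refine iSup_le fun q => ?_
      rw [← Measure.restrict_add_restrict_compl (μ := chartArea x q) hSm]
      exact add_le_add (chartArea_restrict_le hx c q) (Measure.restrict_mono le_rfl le_top)
    refine (Measure.restrict_mono le_rfl h1).trans ?_
    rw [Measure.restrict_add, Measure.restrict_restrict hSm, Set.inter_compl_self,
      Measure.restrict_empty, add_zero]
    exact Measure.restrict_le_self
  · rw [← chartArea_restrict_source x c]
    exact Measure.restrict_mono le_rfl (le_iSup (chartArea x) c)

theorem setIntegral_area {x : M → EuclideanSpace ℝ (Fin (n + 1))}
    (hx : ContMDiff (𝓡∂ n) (𝓡 (n + 1)) ∞ x) (h1 : ∀ p, ‖x p‖ < 1) (c : M) {f : M → ℝ}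
    (hf : Continuous f) :
    ∫ p in (extChartAt (𝓡∂ n) c).source, f p ∂(area x)
      = ∫ y in (extChartAt (𝓡∂ n) c).target, density x c y * f ((extChartAt (𝓡∂ n) c).symm y) := by
  rw [area_restrict_source hx c, chartArea,
    integral_map (aemeasurable_extChartAt_symm x c) hf.measurable.aestronglyMeasurable,
    integral_withDensity_eq_integral_toReal_smul₀]
  · refine integral_congr_ae (Filter.Eventually.of_forall fun y => ?_)
    simp only
    rw [ENNReal.toReal_ofReal (Real.sqrt_nonneg _), smul_eq_mul]
    rfl
  · exact ((continuousOn_density hx h1 c).aemeasurable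
      (measurableSet_extChartAt_target c)).ennreal_ofReal
  · exact Filter.Eventually.of_forall fun y => ENNReal.ofReal_lt_top

/-- By continuity the density is bounded on a small coordinate ball about the chart centre. Local
finiteness makes continuous functions on the compact M integrable. -/
theorem isLocallyFiniteMeasure_area {x : M → EuclideanSpace ℝ (Fin (n + 1))}
    (hx : ContMDiff (𝓡∂ n) (𝓡 (n + 1)) ∞ x) (h1 : ∀ p, ‖x p‖ < 1) :
    IsLocallyFiniteMeasure (area x) := by
  refine ⟨fun c => ?_⟩
  set y₀ := extChartAt (𝓡∂ n) c c
  have hy₀ : y₀ ∈ (extChartAt (𝓡∂ n) c).target := mem_extChartAt_target c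
  have h2 : ∀ᶠ y in nhdsWithin y₀ (extChartAt (𝓡∂ n) c).target,
      density x c y < density x c y₀ + 1 :=
    (continuousOn_density hx h1 c y₀ hy₀).eventually (gt_mem_nhds (lt_add_one _))
  obtain ⟨r, hr, hr2⟩ := Metric.mem_nhdsWithin_iff.1 h2
  have hO : (extChartAt (𝓡∂ n) c).source ∩ extChartAt (𝓡∂ n) c ⁻¹' Metric.ball y₀ r ∈ nhds c :=
    ((continuousOn_extChartAt c).isOpen_inter_preimage (isOpen_extChartAt_source c)
      Metric.isOpen_ball).mem_nhds ⟨mem_extChartAt_source c, Metric.mem_ball_self hr⟩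
  refine ⟨_, hO, ?_⟩
  set O := (extChartAt (𝓡∂ n) c).source ∩ extChartAt (𝓡∂ n) c ⁻¹' Metric.ball y₀ r with hOdef
  have hOm : MeasurableSet O := ((continuousOn_extChartAt c).isOpen_inter_preimage
    (isOpen_extChartAt_source c) Metric.isOpen_ball).measurableSet
  have h3 : area x O = chartArea x c O := by
    rw [← area_restrict_source hx c, Measure.restrict_apply hOm,
      Set.inter_eq_left.2 Set.inter_subset_left]
  rw [h3, chartArea_apply x c hOm]
  have hDm := measurableSet_preimage_inter_target (n := n) c hOm
  have hDsub : (extChartAt (𝓡∂ n) c).symm ⁻¹' O ∩ (extChartAt (𝓡∂ n) c).target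
      ⊆ Metric.ball y₀ r ∩ (extChartAt (𝓡∂ n) c).target := by
    rintro y ⟨hy1, hy2⟩
    refine ⟨?_, hy2⟩
    have := hy1.2
    rwa [Set.mem_preimage, (extChartAt (𝓡∂ n) c).right_inv hy2] at this
  calc ∫⁻ y in (extChartAt (𝓡∂ n) c).symm ⁻¹' O ∩ (extChartAt (𝓡∂ n) c).target,
        ENNReal.ofReal (density x c y)
      ≤ ∫⁻ _ in (extChartAt (𝓡∂ n) c).symm ⁻¹' O ∩ (extChartAt (𝓡∂ n) c).target,
        ENNReal.ofReal (density x c y₀ + 1) :=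
        setLIntegral_mono' hDm fun y hy => ENNReal.ofReal_le_ofReal (hr2 (hDsub hy)).le
    _ = ENNReal.ofReal (density x c y₀ + 1) * volume
        ((extChartAt (𝓡∂ n) c).symm ⁻¹' O ∩ (extChartAt (𝓡∂ n) c).target) :=
        setLIntegral_const _ _
    _ ≤ ENNReal.ofReal (density x c y₀ + 1) * volume (Metric.ball y₀ r) :=
        mul_le_mul_right (measure_mono (hDsub.trans Set.inter_subset_left)) _
    _ < ⊤ := ENNReal.mul_lt_top ENNReal.ofReal_lt_top measure_ball_lt_top

end Area

/-- On the sphere X_a = e^u (⟨x, a⟩ x - |x|² a) is orthogonal to `x`, and the radial part of the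
rotation term is ḡ(X_a, ν) ⟨ν, x⟩ exactly for this `c`, cancelling that of -ḡ(X_a, ν) ν. -/
theorem inner_minkowskiField_of_norm_eq {W : Type*} [NormedAddCommGroup W] [InnerProductSpace ℝ W]
    [FiniteDimensional ℝ W] {R c : ℝ} (a : W) {x ν : W} (hx : ‖x‖ = euclRadius R)
    (hc : c = -(confFactor x ^ 2 * inner ℝ ν x)) :
    inner ℝ x (minkowskiField R c a x ν) = 0 := by
  have h1 : ‖x‖ < 1 := hx ▸ euclRadius_lt_one R
  have he := confFactor_mul h1
  have he0 := (confFactor_pos h1).ne'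
  have h2 : 2 / (1 - euclRadius R ^ 2) = confFactor x := by rw [← hx]; rfl
  have h3 : ‖x‖ ^ 2 = 1 - 2 * (confFactor x)⁻¹ := by
    field_simp
    linarith
  unfold minkowskiField hypMetric
  rw [gradV_eq a h1]
  unfold fieldX
  rw [h2, ← hx, hc]
  simp only [inner_sub_right, inner_add_right, real_inner_smul_right, real_inner_comm ν,
    real_inner_self_eq_norm_sq]
  rw [h3]
  field_simp
  ring

/-! ### The field on the hypersurface: chart independence, continuity, boundary tangency -/

section Immersion

variable {n : ℕ} [NeZero n] {M : Type*} [TopologicalSpace M]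
  [ChartedSpace (EuclideanHalfSpace n) M]

/-- A smooth immersion into the Poincare ball with a smooth unit normal field. -/
structure IsNormalImmersion (x ν : M → EuclideanSpace ℝ (Fin (n + 1))) : Prop where
  smooth : ContMDiff (𝓡∂ n) (𝓡 (n + 1)) ∞ x
  smooth_normal : ContMDiff (𝓡∂ n) (𝓡 (n + 1)) ∞ ν
  norm_lt_one : ∀ p, ‖x p‖ < 1
  injective : ∀ p, Function.Injective (diffCLM (n := n) x p)
  unit : ∀ p, hypMetric (x p) (ν p) (ν p) = 1
  orthogonal : ∀ p v, inner ℝ (ν p) (diffCLM (n := n) x p v) = 0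

/-- The difference of the two integrands of the Minkowski formula. -/
def minkowskiIntegrand (R c : ℝ) (a : EuclideanSpace ℝ (Fin (n + 1)))
    (x ν : M → EuclideanSpace ℝ (Fin (n + 1))) (p : M) : ℝ :=
  n * (weightV a (x p) + c * hypMetric (x p) (fieldY a (x p)) (ν p)) -
    divAlong (diffCLM (n := n) x p) (diffCLM (n := n) ν p) (x p) (ν p) *
      hypMetric (x p) (fieldX R a (x p)) (ν p)

/-- The coordinates of `minkowskiField` in the tangent space of the hypersurface. -/
def minkowskiVector (R c : ℝ) (a : EuclideanSpace ℝ (Fin (n + 1)))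
    (x ν : M → EuclideanSpace ℝ (Fin (n + 1))) (p : M) : EuclideanSpace ℝ (Fin n) :=
  leftInv (diffCLM (n := n) x p) (minkowskiField R c a (x p) (ν p))

/-- The coordinates of `minkowskiField` in the preferred chart at `q`. -/
def chartVector (R c : ℝ) (a : EuclideanSpace ℝ (Fin (n + 1)))
    (x ν : M → EuclideanSpace ℝ (Fin (n + 1))) (q : M) (y : EuclideanSpace ℝ (Fin n)) :
    EuclideanSpace ℝ (Fin n) :=
  leftInv (chartDeriv x q y) (minkowskiField R c a (x ((extChartAt (𝓡∂ n) q).symm y))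
    (ν ((extChartAt (𝓡∂ n) q).symm y)))

theorem finrank_ambient : Module.finrank ℝ (EuclideanSpace ℝ (Fin (n + 1)))
    = Module.finrank ℝ (EuclideanSpace ℝ (Fin n)) + 1 := by
  rw [finrank_euclideanSpace_fin, finrank_euclideanSpace_fin]

variable {x ν : M → EuclideanSpace ℝ (Fin (n + 1))}

namespace IsNormalImmersion

theorem normal_ne_zero (h : IsNormalImmersion x ν) (p : M) : ν p ≠ 0 := by
  intro h0
  have := h.unit p
  simp [hypMetric, h0] at this

theorem continuous_hypMetric (h : IsNormalImmersion x ν)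
    {X Y : M → EuclideanSpace ℝ (Fin (n + 1))} (hX : Continuous X) (hY : Continuous Y) :
    Continuous fun p => hypMetric (x p) (X p) (Y p) :=
  ((continuous_confFactor h.smooth.continuous h.norm_lt_one).pow 2).mul (hX.inner hY)

theorem continuous_fieldX (h : IsNormalImmersion x ν) (R : ℝ) (a : EuclideanSpace ℝ (Fin (n + 1))) :
    Continuous fun p => fieldX R a (x p) := by
  have := h.smooth.continuous
  unfold fieldX
  fun_prop

theorem continuous_fieldY (h : IsNormalImmersion x ν) (a : EuclideanSpace ℝ (Fin (n + 1))) :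
    Continuous fun p => fieldY a (x p) := by
  have := h.smooth.continuous
  unfold fieldY
  fun_prop

theorem continuous_gradV (h : IsNormalImmersion x ν) (a : EuclideanSpace ℝ (Fin (n + 1))) :
    Continuous fun p => gradV a (x p) := by
  have := h.smooth.continuous
  unfold gradV
  fun_prop

theorem continuous_weightV (h : IsNormalImmersion x ν) (a : EuclideanSpace ℝ (Fin (n + 1))) :
    Continuous fun p => weightV a (x p) := by
  simp only [weightV_eq]
  exact (continuous_confFactor h.smooth.continuous h.norm_lt_one).mul
    (h.smooth.continuous.inner continuous_const)

theorem continuous_minkowskiField (h : IsNormalImmersion x ν) (R c : ℝ)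
    (a : EuclideanSpace ℝ (Fin (n + 1))) :
    Continuous fun p => minkowskiField R c a (x p) (ν p) := by
  have hx := h.smooth.continuous
  have hν := h.smooth_normal.continuous
  have hX := h.continuous_fieldX R a
  have hP := h.continuous_gradV a
  exact (hX.sub ((h.continuous_hypMetric hX hν).smul hν)).add
    ((((h.continuous_hypMetric hν hP).smul hx).sub
      ((h.continuous_hypMetric hν hx).smul hP)).const_smul c)

variable [IsManifold (𝓡∂ n) ∞ M]

theorem chartDeriv_eq (h : IsNormalImmersion x ν) {q : M} {y : EuclideanSpace ℝ (Fin n)}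
    (hy : y ∈ (extChartAt (𝓡∂ n) q).target) :
    chartDeriv x q y = diffCLM x ((extChartAt (𝓡∂ n) q).symm y) ∘L chartFrame q y :=
  PoincareBall.chartDeriv_eq hy (h.smooth.mdifferentiableAt (by simp))

theorem injective_chartDeriv (h : IsNormalImmersion x ν) {q : M} {y : EuclideanSpace ℝ (Fin n)}
    (hy : y ∈ (extChartAt (𝓡∂ n) q).target) : Function.Injective (chartDeriv x q y) := by
  obtain ⟨L, hL⟩ := exists_equiv_chartFrame hy
  rw [h.chartDeriv_eq hy, ← hL]
  exact (h.injective _).comp L.injective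

theorem inner_chartDeriv (h : IsNormalImmersion x ν) {q : M} {y : EuclideanSpace ℝ (Fin n)}
    (hy : y ∈ (extChartAt (𝓡∂ n) q).target) (v : EuclideanSpace ℝ (Fin n)) :
    inner ℝ (ν ((extChartAt (𝓡∂ n) q).symm y)) (chartDeriv x q y v) = 0 := by
  rw [h.chartDeriv_eq hy]
  exact h.orthogonal _ _

theorem divAlong_chartDeriv (h : IsNormalImmersion x ν) {q : M} {y : EuclideanSpace ℝ (Fin n)}
    (hy : y ∈ (extChartAt (𝓡∂ n) q).target) (z w : EuclideanSpace ℝ (Fin (n + 1))) :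
    divAlong (chartDeriv x q y) (chartDeriv ν q y) z w
      = divAlong (diffCLM (n := n) x ((extChartAt (𝓡∂ n) q).symm y))
        (diffCLM (n := n) ν ((extChartAt (𝓡∂ n) q).symm y)) z w := by
  obtain ⟨L, hL⟩ := exists_equiv_chartFrame hy
  rw [h.chartDeriv_eq hy, PoincareBall.chartDeriv_eq hy
    (h.smooth_normal.mdifferentiableAt (by simp)), ← hL, divAlong, divAlong,
    traceAlong_comp_equiv (h.injective _) finrank_ambient (h.normal_ne_zero _) (h.orthogonal _)]

theorem chartDeriv_chartVector (h : IsNormalImmersion x ν) (R c : ℝ)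
    (a : EuclideanSpace ℝ (Fin (n + 1))) {ρ : M → ℝ} (hρ : ContMDiff (𝓡∂ n) 𝓘(ℝ, ℝ) ∞ ρ) {q : M}
    {y : EuclideanSpace ℝ (Fin n)} (hy : y ∈ (extChartAt (𝓡∂ n) q).target) :
    chartDeriv ρ q y (chartVector R c a x ν q y)
      = diffCLM ρ ((extChartAt (𝓡∂ n) q).symm y)
        (minkowskiVector R c a x ν ((extChartAt (𝓡∂ n) q).symm y)) := by
  obtain ⟨L, hL⟩ := exists_equiv_chartFrame hy
  rw [chartVector, h.chartDeriv_eq hy, PoincareBall.chartDeriv_eq hy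
    (hρ.mdifferentiableAt (by simp)), ← hL,
    leftInv_comp_equiv (h.injective _) finrank_ambient (h.normal_ne_zero _) (h.orthogonal _)]
  simp [minkowskiVector]

theorem continuousOn_leftInv_chartDeriv (h : IsNormalImmersion x ν) (q : M) :
    ContinuousOn (fun y => leftInv (chartDeriv x q y)) (extChartAt (𝓡∂ n) q).target :=
  fun y hy => (contDiffAt_leftInv (h.injective_chartDeriv hy)).continuousAt.comp_continuousWithinAt
    (continuousOn_chartDeriv h.smooth q y hy)

theorem continuousOn_chartVector (h : IsNormalImmersion x ν) (R c : ℝ)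
    (a : EuclideanSpace ℝ (Fin (n + 1))) (q : M) :
    ContinuousOn (chartVector R c a x ν q) (extChartAt (𝓡∂ n) q).target :=
  (h.continuousOn_leftInv_chartDeriv q).clm_apply
    ((h.continuous_minkowskiField R c a).comp_continuousOn (continuousOn_extChartAt_symm q))

end IsNormalImmersion

theorem continuous_of_continuousOn_charts {f : M → ℝ}
    (hf : ∀ q, ContinuousOn (f ∘ (extChartAt (𝓡∂ n) q).symm) (extChartAt (𝓡∂ n) q).target) :
    Continuous f := by
  rw [continuous_iff_continuousAt]
  intro q
  have h1 : ContinuousOn f (extChartAt (𝓡∂ n) q).source := by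
    refine ((hf q).comp (continuousOn_extChartAt q) fun p hp =>
      (extChartAt (𝓡∂ n) q).map_source hp).congr fun p hp => ?_
    simp only [Function.comp_apply]
    rw [(extChartAt (𝓡∂ n) q).left_inv hp]
  exact h1.continuousAt (extChartAt_source_mem_nhds q)

namespace IsNormalImmersion

variable [IsManifold (𝓡∂ n) ∞ M]

/-- The matrix of `diffCLM` at `p` refers to the preferred chart at `p`, which need not vary
continuously. Invariance of the divergence allows the use of one fixed chart near each point. -/
theorem continuous_divAlong (h : IsNormalImmersion x ν) :
    Continuous fun p => divAlong (diffCLM (n := n) x p) (diffCLM (n := n) ν p) (x p) (ν p) := by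
  refine continuous_of_continuousOn_charts (n := n) fun q => ?_
  have h1 : Continuous fun T : EuclideanSpace ℝ (Fin n) →L[ℝ] EuclideanSpace ℝ (Fin n) =>
      LinearMap.trace ℝ (EuclideanSpace ℝ (Fin n)) (T : _ →ₗ[ℝ] _) :=
    LinearMap.continuous_of_finiteDimensional
      ((LinearMap.trace ℝ (EuclideanSpace ℝ (Fin n))) ∘ₗ ContinuousLinearMap.coeLM ℝ)
  have h2 : ContinuousOn (fun y => traceAlong (chartDeriv x q y) (chartDeriv ν q y))
      (extChartAt (𝓡∂ n) q).target :=
    h1.comp_continuousOn ((h.continuousOn_leftInv_chartDeriv q).clm_comp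
      (continuousOn_chartDeriv h.smooth_normal q))
  have h3 : Continuous fun p => (Module.finrank ℝ (EuclideanSpace ℝ (Fin n)) : ℝ) *
      (confFactor (x p) * inner ℝ (x p) (ν p)) :=
    continuous_const.mul ((continuous_confFactor h.smooth.continuous h.norm_lt_one).mul
      (h.smooth.continuous.inner h.smooth_normal.continuous))
  refine (h2.add (h3.comp_continuousOn (continuousOn_extChartAt_symm q))).congr fun y hy => ?_
  exact (h.divAlong_chartDeriv hy _ _).symm

theorem continuous_minkowskiIntegrand (h : IsNormalImmersion x ν) (R c : ℝ)
    (a : EuclideanSpace ℝ (Fin (n + 1))) : Continuous (minkowskiIntegrand R c a x ν) :=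
  (continuous_const.mul ((h.continuous_weightV a).add (continuous_const.mul
    (h.continuous_hypMetric (h.continuous_fieldY a) h.smooth_normal.continuous)))).sub
    (h.continuous_divAlong.mul (h.continuous_hypMetric (h.continuous_fieldX R a)
      h.smooth_normal.continuous))

theorem continuous_diffCLM_minkowskiVector (h : IsNormalImmersion x ν) (R c : ℝ)
    (a : EuclideanSpace ℝ (Fin (n + 1))) {ρ : M → ℝ} (hρ : ContMDiff (𝓡∂ n) 𝓘(ℝ, ℝ) ∞ ρ) :
    Continuous fun p => diffCLM (n := n) ρ p (minkowskiVector R c a x ν p) := by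
  refine continuous_of_continuousOn_charts (n := n) fun q => ?_
  refine ((continuousOn_chartDeriv hρ q).clm_apply
    (h.continuousOn_chartVector R c a q)).congr fun y hy => ?_
  exact (h.chartDeriv_chartVector R c a hρ hy).symm

/-- The vector field is tangent to the boundary. -/
theorem chartVector_zero_eq_zero (h : IsNormalImmersion x ν) {R c : ℝ}
    (a : EuclideanSpace ℝ (Fin (n + 1)))
    (hR : ∀ p ∈ (𝓡∂ n).boundary M, ‖x p‖ = euclRadius R)
    (hc : ∀ p ∈ (𝓡∂ n).boundary M, c = -(confFactor (x p) ^ 2 * inner ℝ (ν p) (x p)))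
    (hne : ∀ p ∈ (𝓡∂ n).boundary M, inner ℝ (ν p) (x p) ^ 2 ≠ ‖ν p‖ ^ 2 * ‖x p‖ ^ 2)
    (q : M) {y : EuclideanSpace ℝ (Fin n)} (hy : y ∈ (extChartAt (𝓡∂ n) q).target)
    (hy0 : y 0 = 0) : chartVector R c a x ν q y 0 = 0 := by
  have hM : IsManifold (𝓡∂ n) 1 M := isManifold_one
  -- Being an interior point can be tested in any chart of the atlas, in particular the one at `q`.
  have hbd : ∀ z ∈ (extChartAt (𝓡∂ n) q).target, z 0 = 0 →
      (extChartAt (𝓡∂ n) q).symm z ∈ (𝓡∂ n).boundary M := by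
    intro z hz hz0
    rw [← ModelWithCorners.compl_interior]
    intro hint
    have hsrc : (extChartAt (𝓡∂ n) q).symm z ∈ (chartAt (EuclideanHalfSpace n) q).source := by
      rw [← extChartAt_source (𝓡∂ n)]
      exact (extChartAt (𝓡∂ n) q).map_target hz
    have h1 := ((𝓡∂ n).isInteriorPoint_iff_of_mem_atlas (n := 1) one_ne_zero
      (chart_mem_atlas _ q) hsrc).1 hint
    have h2 := interior_mono (extChartAt_target_subset_range (I := 𝓡∂ n) q) h1
    rw [interior_range_modelWithCornersEuclideanHalfSpace] at h2
    have h3 : (chartAt (EuclideanHalfSpace n) q).extend (𝓡∂ n) ((extChartAt (𝓡∂ n) q).symm z) = z :=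
      (extChartAt (𝓡∂ n) q).right_inv hz
    rw [h3] at h2
    exact absurd hz0 (ne_of_gt h2)
  set p := (extChartAt (𝓡∂ n) q).symm y with hp
  have hpb := hbd y hy hy0
  set A := chartDeriv x q y with hA
  have hAinj : Function.Injective A := h.injective_chartDeriv hy
  have hAν : ∀ v, inner ℝ (ν p) (A v) = 0 := h.inner_chartDeriv hy
  have hder : HasFDerivWithinAt (x ∘ (extChartAt (𝓡∂ n) q).symm) A (Set.range (𝓡∂ n)) y := by
    rw [hA, h.chartDeriv_eq hy]
    exact hasFDerivWithinAt_comp_extChartAt_symm hy (h.smooth.mdifferentiableAt (by simp))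
  -- For w₀ = 0 the line y + t w stays in the boundary of the half space, where |x|² is constant.
  have htan : ∀ w : EuclideanSpace ℝ (Fin n), w 0 = 0 → inner ℝ (x p) (A w) = 0 := by
    intro w hw
    have hline : HasDerivAt (fun t : ℝ => y + t • w) w 0 := by
      simpa using ((hasDerivAt_id (0 : ℝ)).smul_const w).const_add y
    have hmaps : ∀ t : ℝ, y + t • w ∈ Set.range (𝓡∂ n) := by
      intro t
      rw [range_modelWithCornersEuclideanHalfSpace]
      simp [hy0, hw]
    have h1 : HasDerivAt (fun t : ℝ => (x ∘ (extChartAt (𝓡∂ n) q).symm) (y + t • w)) (A w) 0 := by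
      have h2 : HasFDerivWithinAt (x ∘ (extChartAt (𝓡∂ n) q).symm) A (Set.range (𝓡∂ n))
          (y + (0 : ℝ) • w) := by simpa using hder
      have h3 := h2.comp_hasDerivWithinAt (s := Set.univ) (0 : ℝ) hline.hasDerivWithinAt
        (fun t _ => hmaps t)
      simpa [Function.comp_def] using h3
    have h4 : (fun t : ℝ => ‖(x ∘ (extChartAt (𝓡∂ n) q).symm) (y + t • w)‖ ^ 2)
        =ᶠ[nhds 0] fun _ => euclRadius R ^ 2 := by
      have h5 : Filter.Tendsto (fun t : ℝ => y + t • w) (nhds 0)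
          (nhdsWithin y (Set.range (𝓡∂ n))) := by
        refine tendsto_nhdsWithin_iff.2 ⟨?_, Filter.Eventually.of_forall hmaps⟩
        simpa using hline.continuousAt.tendsto
      filter_upwards [h5 (chart_target_mem_nhdsWithin hy)] with t ht
      rw [Function.comp_apply, hR _ (hbd _ ht (by simp [hy0, hw]))]
    have h6 := h1.norm_sq.unique ((hasDerivAt_const (0 : ℝ) _).congr_of_eventuallyEq h4)
    simp only [Function.comp_apply, zero_smul, add_zero] at h6
    rw [← hp] at h6
    linarith
  set Z := minkowskiField R c a (x p) (ν p) with hZ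
  have hAT : A (chartVector R c a x ν q y) = Z := by
    have h1 := apply_leftInv hAinj finrank_ambient (h.normal_ne_zero p) hAν Z
    rw [hZ, inner_minkowskiField R c a (h.unit p), zero_div, zero_smul, sub_zero] at h1
    exact h1
  have hxZ : inner ℝ (x p) Z = 0 :=
    inner_minkowskiField_of_norm_eq a (hR p hpb) (hc p hpb)
  set T := chartVector R c a x ν q y with hT
  set e₀ : EuclideanSpace ℝ (Fin n) := EuclideanSpace.single 0 1 with he₀
  have hsplit : ∀ v : EuclideanSpace ℝ (Fin n),
      inner ℝ (x p) (A v) = v 0 * inner ℝ (x p) (A e₀) := by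
    intro v
    have h1 := htan (v - v 0 • e₀) (by simp [he₀])
    rw [map_sub, map_smul, inner_sub_right, real_inner_smul_right] at h1
    linarith
  rw [← hAT, hsplit] at hxZ
  -- If ⟨x, A e₀⟩ were zero, `x` would be normal to the hypersurface, hence parallel to `ν`:
  -- equality in Cauchy-Schwarz, excluded by `hne`.
  refine (mul_eq_zero.1 hxZ).resolve_right fun h0 => hne p hpb ?_
  have h1 : leftInv A (x p) = 0 := leftInv_eq_zero fun v => by rw [hsplit, h0, mul_zero]
  have h2 := apply_leftInv hAinj finrank_ambient (h.normal_ne_zero p) hAν (x p)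
  rw [h1, map_zero] at h2
  have h3 := congrArg (fun z => inner ℝ (x p) z) h2
  have h4 : ‖ν p‖ ^ 2 ≠ 0 := by
    have := h.normal_ne_zero p
    positivity
  simp only [inner_zero_right, inner_sub_right, real_inner_smul_right, real_inner_self_eq_norm_sq,
    real_inner_comm (ν p) (x p)] at h3
  have h5 : inner ℝ (ν p) (x p) ^ 2 / ‖ν p‖ ^ 2 = ‖x p‖ ^ 2 := by
    rw [div_mul_eq_mul_div, ← pow_two] at h3
    linarith
  rw [div_eq_iff h4] at h5
  linarith

end IsNormalImmersion

end Immersion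

/-- A function which is continuous on a relatively open subset `U` of `H` and which vanishes outside
of a closed subset of `U` extends continuously by zero. -/
theorem continuousOn_indicator_of_eq_zero {X G : Type*} [TopologicalSpace X] [TopologicalSpace G]
    [Zero G] {U K H : Set X} {g : X → G} (hU : ∀ y ∈ U, U ∈ nhdsWithin y H) (hg : ContinuousOn g U)
    (hK : IsClosed K) (hKU : K ⊆ U) (hgK : ∀ y ∈ U, y ∉ K → g y = 0) :
    ContinuousOn (U.indicator g) H := by
  intro y _
  by_cases hyU : y ∈ U
  · have h1 : ContinuousWithinAt (U.indicator g) U y :=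
      (hg y hyU).congr (fun z hz => Set.indicator_of_mem hz g) (Set.indicator_of_mem hyU g)
    exact h1.mono_of_mem_nhdsWithin (hU y hyU)
  · have h1 : U.indicator g =ᶠ[nhds y] fun _ => 0 := by
      filter_upwards [hK.isOpen_compl.mem_nhds fun h => hyU (hKU h)] with z hz
      by_cases hzU : z ∈ U
      · rw [Set.indicator_of_mem hzU, hgK z hzU hz]
      · exact Set.indicator_of_notMem hzU g
    exact (continuousAt_const.congr h1.symm).continuousWithinAt

/-! ### Globalisation by a partition of unity -/

section Minkowski

variable {n : ℕ} [NeZero n] {M : Type*} [TopologicalSpace M]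
  [ChartedSpace (EuclideanHalfSpace n) M] [IsManifold (𝓡∂ n) ∞ M]
  {x ν : M → EuclideanSpace ℝ (Fin (n + 1))}

namespace IsNormalImmersion

/-- The local divergence formula at interior points of a chart. -/
theorem exists_hasFDerivAt_chartVector (h : IsNormalImmersion x ν) (R c : ℝ)
    (a : EuclideanSpace ℝ (Fin (n + 1))) {ρ : M → ℝ} (hρ : ContMDiff (𝓡∂ n) 𝓘(ℝ, ℝ) ∞ ρ) (q : M)
    {y : EuclideanSpace ℝ (Fin n)} (hy : y ∈ (extChartAt (𝓡∂ n) q).target) (hy0 : 0 < y 0) :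
    ∃ D : EuclideanSpace ℝ (Fin n) →L[ℝ] EuclideanSpace ℝ (Fin n),
      HasFDerivAt (fun z => (ρ ((extChartAt (𝓡∂ n) q).symm z) * density x q z) •
        chartVector R c a x ν q z) D y ∧
      LinearMap.trace ℝ (EuclideanSpace ℝ (Fin n)) (D : _ →ₗ[ℝ] _) = density x q y *
        (ρ ((extChartAt (𝓡∂ n) q).symm y) *
          minkowskiIntegrand R c a x ν ((extChartAt (𝓡∂ n) q).symm y) +
          diffCLM (n := n) ρ ((extChartAt (𝓡∂ n) q).symm y)
            (minkowskiVector R c a x ν ((extChartAt (𝓡∂ n) q).symm y))) := by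
  have hrange : ∀ z : EuclideanSpace ℝ (Fin n), 0 < z 0 → Set.range (𝓡∂ n) ∈ nhds z := by
    intro z hz
    rw [← mem_interior_iff_mem_nhds, interior_range_modelWithCornersEuclideanHalfSpace]
    exact hz
  have htarget : ∀ z ∈ (extChartAt (𝓡∂ n) q).target, 0 < z 0 →
      (extChartAt (𝓡∂ n) q).target ∈ nhds z := by
    intro z hz hz0
    have h1 := chart_target_mem_nhdsWithin hz
    rwa [nhdsWithin_eq_nhds.2 (hrange z hz0)] at h1
  have hpos : ∀ᶠ z : EuclideanSpace ℝ (Fin n) in nhds y, 0 < z 0 := by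
    have h1 : Continuous fun z : EuclideanSpace ℝ (Fin n) => z 0 := by fun_prop
    exact h1.continuousAt.eventually (lt_mem_nhds hy0)
  have hev : ∀ᶠ z in nhds y, z ∈ (extChartAt (𝓡∂ n) q).target ∧ 0 < z 0 :=
    (Filter.eventually_of_mem (htarget y hy hy0) fun _ hz => hz).and hpos
  have hfd : ∀ {G : Type} [NormedAddCommGroup G] [NormedSpace ℝ G] (f : M → G)
      (z : EuclideanSpace ℝ (Fin n)), 0 < z 0 →
      fderiv ℝ (f ∘ (extChartAt (𝓡∂ n) q).symm) z = chartDeriv f q z :=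
    fun f z hz => (fderivWithin_of_mem_nhds (hrange z hz)).symm
  have hF := (contDiffOn_comp_extChartAt_symm h.smooth q).contDiffAt (htarget y hy hy0)
  have hN := (contDiffOn_comp_extChartAt_symm h.smooth_normal q).contDiffAt (htarget y hy hy0)
  have hr := (contDiffOn_comp_extChartAt_symm hρ q).contDiffAt (htarget y hy hy0)
  obtain ⟨D, hD, hDt⟩ := exists_hasFDerivAt_density_smul_minkowskiField
    (F := x ∘ (extChartAt (𝓡∂ n) q).symm) (N := ν ∘ (extChartAt (𝓡∂ n) q).symm)
    (ρ := ρ ∘ (extChartAt (𝓡∂ n) q).symm) (y := y) finrank_euclideanSpace_fin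
    (hF.of_le (WithTop.coe_le_coe.2 (le_top (a := (2 : ℕ∞))))) (hN.differentiableAt (by simp))
    (hr.differentiableAt (by simp))
    (hev.mono fun z hz => by
      rw [hfd x z hz.2]
      exact ⟨h.injective_chartDeriv hz.1, h.norm_lt_one _, h.unit _, h.inner_chartDeriv hz.1⟩)
    R c a
  refine ⟨D, hD.congr_of_eventuallyEq (hev.mono fun z hz => ?_), ?_⟩
  · simp only [hfd x z hz.2]
    rfl
  · rw [hDt, hfd x y hy0, hfd ν y hy0, hfd ρ y hy0]
    simp only [Function.comp_apply]
    rw [h.divAlong_chartDeriv hy]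
    have h1 := h.chartDeriv_chartVector R c a hρ hy
    unfold chartVector at h1
    rw [h1]
    rfl

variable [MeasurableSpace M] [BorelSpace M] [CompactSpace M]

/-- The divergence theorem for a function supported in a chart domain. -/
theorem integral_eq_zero_of_tsupport_subset (h : IsNormalImmersion x ν) {R c : ℝ}
    {a : EuclideanSpace ℝ (Fin (n + 1))} {ρ : M → ℝ} (hρ : ContMDiff (𝓡∂ n) 𝓘(ℝ, ℝ) ∞ ρ) (q : M)
    (hsupp : tsupport ρ ⊆ (extChartAt (𝓡∂ n) q).source)
    (htan : ∀ y ∈ (extChartAt (𝓡∂ n) q).target, y 0 = 0 → chartVector R c a x ν q y 0 = 0) :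
    ∫ p, (ρ p * minkowskiIntegrand R c a x ν p +
      diffCLM (n := n) ρ p (minkowskiVector R c a x ν p)) ∂(area x) = 0 := by
  set f : M → ℝ := fun p => ρ p * minkowskiIntegrand R c a x ν p +
      diffCLM (n := n) ρ p (minkowskiVector R c a x ν p) with hfdef
  have hf : Continuous f := (hρ.continuous.mul (h.continuous_minkowskiIntegrand R c a)).add
    (h.continuous_diffCLM_minkowskiVector R c a hρ)
  have hf0 : ∀ p, p ∉ tsupport ρ → f p = 0 := by
    intro p hp
    have h1 : diffCLM (n := n) ρ p = 0 :=
      diffCLM_eq_zero_of_eventuallyEq (notMem_tsupport_iff_eventuallyEq.1 hp)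
    simp [hfdef, h1, image_eq_zero_of_notMem_tsupport hp]
  set U := (extChartAt (𝓡∂ n) q).target with hU
  set K := extChartAt (𝓡∂ n) q '' tsupport ρ with hKdef
  have hKc : IsCompact K := (isClosed_tsupport ρ).isCompact.image_of_continuousOn
    ((continuousOn_extChartAt q).mono hsupp)
  have hKU : K ⊆ U := by
    rintro _ ⟨p, hp, rfl⟩
    exact (extChartAt (𝓡∂ n) q).map_source (hsupp hp)
  have hK : ∀ y ∈ U, y ∉ K → (extChartAt (𝓡∂ n) q).symm y ∉ tsupport ρ := by
    intro y hy hyK hp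
    exact hyK ⟨_, hp, (extChartAt (𝓡∂ n) q).right_inv hy⟩
  have hUH : ∀ y ∈ U, U ∈ nhdsWithin y {y : EuclideanSpace ℝ (Fin n) | 0 ≤ y 0} := by
    intro y hy
    rw [← range_modelWithCornersEuclideanHalfSpace]
    exact chart_target_mem_nhdsWithin hy
  have hUsub : U ⊆ {y : EuclideanSpace ℝ (Fin n) | 0 ≤ y 0} := by
    rw [← range_modelWithCornersEuclideanHalfSpace]
    exact extChartAt_target_subset_range q
  set g : EuclideanSpace ℝ (Fin n) → ℝ :=
    fun y => density x q y * f ((extChartAt (𝓡∂ n) q).symm y)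
  set G : EuclideanSpace ℝ (Fin n) → EuclideanSpace ℝ (Fin n) :=
    fun y => (ρ ((extChartAt (𝓡∂ n) q).symm y) * density x q y) • chartVector R c a x ν q y
  have hw := continuousOn_density h.smooth h.norm_lt_one q
  have hsymm := continuousOn_extChartAt_symm (I := 𝓡∂ n) q
  have hg : ContinuousOn g U := hw.mul (hf.comp_continuousOn hsymm)
  have hG : ContinuousOn G U :=
    ((hρ.continuous.comp_continuousOn hsymm).mul hw).smul (h.continuousOn_chartVector R c a q)
  have hgK : ∀ y ∈ U, y ∉ K → g y = 0 := by
    intro y hy hyK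
    simp only [g]
    rw [hf0 _ (hK y hy hyK), mul_zero]
  have hGK : ∀ y ∈ U, y ∉ K → G y = 0 := by
    intro y hy hyK
    simp only [G]
    rw [image_eq_zero_of_notMem_tsupport (hK y hy hyK), zero_mul, zero_smul]
  have hgK' : ∀ y, y ∉ K → U.indicator g y = 0 := fun y hy => by
    by_cases hyU : y ∈ U
    · rw [Set.indicator_of_mem hyU, hgK y hyU hy]
    · exact Set.indicator_of_notMem hyU g
  have hGK' : ∀ y, y ∉ K → U.indicator G y = 0 := fun y hy => by
    by_cases hyU : y ∈ U
    · rw [Set.indicator_of_mem hyU, hGK y hyU hy]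
    · exact Set.indicator_of_notMem hyU G
  -- Extended by zero from the chart target, field and divergence stay continuous on the closed half
  -- space, because `ρ` has support in the chart domain.
  have hmain := integral_halfSpace_trace_eq_zero (f := U.indicator G) (d := U.indicator g)
    (D := fderiv ℝ (U.indicator G)) hKc.isBounded
    (continuousOn_indicator_of_eq_zero hUH hG hKc.isClosed hKU hGK)
    (continuousOn_indicator_of_eq_zero hUH hg hKc.isClosed hKU hgK) hGK' hgK' ?_ ?_
  · calc ∫ p, f p ∂(area x) = ∫ p in (extChartAt (𝓡∂ n) q).source, f p ∂(area x) :=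
          (setIntegral_eq_integral_of_forall_compl_eq_zero fun p hp =>
            hf0 p fun hp' => hp (hsupp hp')).symm
      _ = ∫ y in U, g y := setIntegral_area h.smooth h.norm_lt_one q hf
      _ = ∫ y in {y : EuclideanSpace ℝ (Fin n) | 0 ≤ y 0}, U.indicator g y := by
          rw [setIntegral_indicator (measurableSet_extChartAt_target q),
            Set.inter_eq_right.2 hUsub]
      _ = 0 := hmain
  · intro y hy0
    by_cases hyU : y ∈ U
    · rw [Set.indicator_of_mem hyU]
      simp only [G]
      rw [PiLp.smul_apply, htan y hyU hy0, smul_zero]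
    · rw [Set.indicator_of_notMem hyU]
      rfl
  · intro y hy0
    by_cases hyU : y ∈ U
    · obtain ⟨D, hD, hDt⟩ := h.exists_hasFDerivAt_chartVector R c a hρ q hyU hy0
      have hrange : {y : EuclideanSpace ℝ (Fin n) | 0 ≤ y 0} ∈ nhds y := by
        have h1 : Continuous fun z : EuclideanSpace ℝ (Fin n) => z 0 := by fun_prop
        filter_upwards [h1.continuousAt.eventually (lt_mem_nhds hy0)] with z hz
        exact le_of_lt hz
      have hUn : U ∈ nhds y := by
        have h1 := hUH y hyU
        rwa [nhdsWithin_eq_nhds.2 hrange] at h1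
      have hD2 : HasFDerivAt (U.indicator G) D y :=
        hD.congr_of_eventuallyEq (Filter.eventually_of_mem hUn fun z hz =>
          Set.indicator_of_mem hz G)
      rw [hD2.fderiv]
      exact ⟨hD2, by rw [hDt, Set.indicator_of_mem hyU]⟩
    · have h1 : U.indicator G =ᶠ[nhds y] fun _ => 0 := by
        filter_upwards [hKc.isClosed.isOpen_compl.mem_nhds fun hy => hyU (hKU hy)] with z hz
        exact hGK' z hz
      have h2 : HasFDerivAt (U.indicator G)
          (0 : EuclideanSpace ℝ (Fin n) →L[ℝ] EuclideanSpace ℝ (Fin n)) y :=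
        (hasFDerivAt_const 0 y).congr_of_eventuallyEq h1
      rw [h2.fderiv, Set.indicator_of_notMem hyU]
      exact ⟨h2, by simp⟩

variable [T2Space M]

theorem integral_minkowskiIntegrand_eq_zero (h : IsNormalImmersion x ν) {R c : ℝ}
    {a : EuclideanSpace ℝ (Fin (n + 1))}
    (htan : ∀ q : M, ∀ y ∈ (extChartAt (𝓡∂ n) q).target, y 0 = 0 →
      chartVector R c a x ν q y 0 = 0) :
    ∫ p, minkowskiIntegrand R c a x ν p ∂(area x) = 0 := by
  have := isLocallyFiniteMeasure_area h.smooth h.norm_lt_one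
  obtain ⟨ρ, hρ⟩ := SmoothPartitionOfUnity.exists_isSubordinate_chartAt_source (𝓡∂ n) M
  have hfin : {i | (Function.support (ρ i)).Nonempty}.Finite :=
    ρ.locallyFinite.finite_nonempty_of_compact
  set s := hfin.toFinset with hs
  have hsum : ∀ p, ∑ i ∈ s, ρ i p = 1 := by
    intro p
    rw [← ρ.sum_eq_one (Set.mem_univ p)]
    refine (finsum_eq_sum_of_support_subset _ fun i hi => ?_).symm
    rw [hs, Set.Finite.coe_toFinset]
    exact ⟨p, hi⟩
  have hsmooth : ∀ i, ContMDiff (𝓡∂ n) 𝓘(ℝ, ℝ) ∞ (ρ i) := fun i => (ρ i).contMDiff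
  have hdiff : ∀ p, ∑ i ∈ s, diffCLM (n := n) (ρ i) p = 0 := by
    intro p
    have hc : (fun q => ∑ i ∈ s, ρ i q) = fun _ => (1 : ℝ) := funext hsum
    rw [← diffCLM_sum s (f := fun i => ρ i)
      (fun i _ => (hsmooth i).mdifferentiableAt (by simp)) (by rw [hc]; exact mdifferentiableAt_const)]
    exact diffCLM_eq_zero_of_eventuallyEq (Filter.Eventually.of_forall hsum)
  -- The cut-off terms dρᵢ(Z) add up to zero because ∑ ρᵢ = 1.
  have hpt : ∀ p, minkowskiIntegrand R c a x ν p = ∑ i ∈ s,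
      (ρ i p * minkowskiIntegrand R c a x ν p +
        diffCLM (n := n) (ρ i) p (minkowskiVector R c a x ν p)) := by
    intro p
    rw [Finset.sum_add_distrib, ← Finset.sum_mul, hsum, one_mul, ← sum_apply, hdiff]
    simp
  rw [integral_congr_ae (Filter.Eventually.of_forall hpt), integral_finsetSum]
  · refine Finset.sum_eq_zero fun i _ => ?_
    refine h.integral_eq_zero_of_tsupport_subset (hsmooth i) i ?_ (htan i)
    rw [extChartAt_source]
    exact hρ i
  · intro i _
    exact (((hsmooth i).continuous.mul (h.continuous_minkowskiIntegrand R c a)).add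
      (h.continuous_diffCLM_minkowskiVector R c a (hsmooth i))).integrable_of_hasCompactSupport
        (HasCompactSupport.of_compactSpace _)

end IsNormalImmersion

theorem norm_lt_one_of_mem {R : ℝ} (hint : ∀ p ∈ (𝓡∂ n).interior M, x p ∈ openHypBall R)
    (hbdry : ∀ p ∈ (𝓡∂ n).boundary M, x p ∈ hypSphere R) (p : M) : ‖x p‖ < 1 := by
  have h := (𝓡∂ n).interior_union_boundary_eq_univ (M := M)
  rcases (h ▸ Set.mem_univ p : p ∈ (𝓡∂ n).interior M ∪ (𝓡∂ n).boundary M) with hp | hp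
  · exact (hint p hp).1
  · exact (hbdry p hp).1

/-- On the sphere e^u = cosh R + 1, so the claim is (cosh R + 1)(cosh R - 1) = sinh² R. It expresses
that x / sinh R is a unit vector. -/
theorem confFactor_mul_norm_sq {E : Type*} [NormedAddCommGroup E] [InnerProductSpace ℝ E]
    [FiniteDimensional ℝ E] {R : ℝ} {z : E} (hz : ‖z‖ = euclRadius R) :
    confFactor z ^ 2 * ‖z‖ ^ 2 = Real.sinh R ^ 2 := by
  have h1 := Real.one_le_cosh R
  have h2 : euclRadius R ^ 2 = (Real.cosh R - 1) / (Real.cosh R + 1) :=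
    Real.sq_sqrt (div_nonneg (by linarith) (by linarith))
  have h3 : confFactor z = Real.cosh R + 1 := by
    rw [confFactor, hz, h2]
    field_simp
    ring
  rw [h3, hz, h2, Real.sinh_sq]
  field_simp
  ring

end Minkowski

end PoincareBall

end

theorem mainTheorem6
    {n : ℕ} [NeZero n]
    {M : Type*} [TopologicalSpace M] [T2Space M] [CompactSpace M]
    [ChartedSpace (EuclideanHalfSpace n) M] [IsManifold (𝓡∂ n) ∞ M]
    [MeasurableSpace M] [BorelSpace M]
    (R : ℝ) (hR : 0 < R) (θ : ℝ) (hθ : θ ∈ Set.Ioo 0 Real.pi)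
    (a : EuclideanSpace ℝ (Fin (n + 1)))
    (x ν : M → EuclideanSpace ℝ (Fin (n + 1)))
    -- `x` is a smooth immersion
    (hx : ContMDiff (𝓡∂ n) (𝓡 (n + 1)) ∞ x)
    (himm : ∀ p : M, Function.Injective (PoincareBall.diff x p))
    -- into the closed hyperbolic ball, interior to interior and boundary to boundary
    (hint : ∀ p ∈ (𝓡∂ n).interior M, x p ∈ PoincareBall.openHypBall R)
    (hbdry : ∀ p ∈ (𝓡∂ n).boundary M, x p ∈ PoincareBall.hypSphere R)
    -- `ν` is a smooth unit normal field along `x`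
    (hν : ContMDiff (𝓡∂ n) (𝓡 (n + 1)) ∞ ν)
    (hunit : ∀ p : M, PoincareBall.hypMetric (x p) (ν p) (ν p) = 1)
    (hnormal : ∀ (p : M) (v : TangentSpace (𝓡∂ n) p),
      PoincareBall.hypMetric (x p) (ν p) (PoincareBall.diff x p v) = 0)
    -- along the boundary, the angle between `-ν` and the outward normal of the sphere is `θ`
    (hangle : ∀ p ∈ (𝓡∂ n).boundary M,
      PoincareBall.hypMetric (x p) (-ν p) (PoincareBall.sphereNormal R (x p)) = Real.cos θ) :
    MeasureTheory.Integrable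
        (fun p => (n : ℝ) * (PoincareBall.weightV a (x p) + Real.sinh R * Real.cos θ *
          PoincareBall.hypMetric (x p) (PoincareBall.fieldY a (x p)) (ν p)))
        (PoincareBall.area x) ∧
      MeasureTheory.Integrable
        (fun p => PoincareBall.meanCurvature x ν p *
          PoincareBall.hypMetric (x p) (PoincareBall.fieldX R a (x p)) (ν p))
        (PoincareBall.area x) ∧
      ∫ p, (n : ℝ) * (PoincareBall.weightV a (x p) + Real.sinh R * Real.cos θ *
          PoincareBall.hypMetric (x p) (PoincareBall.fieldY a (x p)) (ν p))
          ∂(PoincareBall.area x) =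
        ∫ p, PoincareBall.meanCurvature x ν p *
          PoincareBall.hypMetric (x p) (PoincareBall.fieldX R a (x p)) (ν p)
          ∂(PoincareBall.area x) := by
  open PoincareBall in
  have hlt : ∀ p, ‖x p‖ < 1 := norm_lt_one_of_mem hint hbdry
  have h : IsNormalImmersion x ν :=
    { smooth := hx
      smooth_normal := hν
      norm_lt_one := hlt
      injective := himm
      unit := hunit
      orthogonal := fun p v => (mul_eq_zero.1 (hnormal p v)).resolve_left
        (pow_ne_zero 2 (confFactor_pos (hlt p)).ne') }
  have hH : ∀ p, meanCurvature x ν p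
      = divAlong (diffCLM (n := n) x p) (diffCLM (n := n) ν p) (x p) (ν p) := fun p =>
    trace_inv_mul_secondForm (B := diffCLM (n := n) ν p) (h.injective p) (hlt p) (h.orthogonal p)
  have := isLocallyFiniteMeasure_area hx hlt
  have hint1 : Integrable (fun p => (n : ℝ) * (weightV a (x p) + Real.sinh R * Real.cos θ *
      hypMetric (x p) (fieldY a (x p)) (ν p))) (area x) :=
    (continuous_const.mul ((h.continuous_weightV a).add (continuous_const.mul
      (h.continuous_hypMetric (h.continuous_fieldY a)
        hν.continuous)))).integrable_of_hasCompactSupport (HasCompactSupport.of_compactSpace _)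
  have hint2 : Integrable (fun p => meanCurvature x ν p * hypMetric (x p) (fieldX R a (x p)) (ν p))
      (area x) := by
    simp only [hH]
    exact (h.continuous_divAlong.mul (h.continuous_hypMetric (h.continuous_fieldX R a)
      hν.continuous)).integrable_of_hasCompactSupport (HasCompactSupport.of_compactSpace _)
  refine ⟨hint1, hint2, ?_⟩
  rw [← sub_eq_zero, ← integral_sub hint1 hint2]
  simp only [hH]
  have hnorm : ∀ p ∈ (𝓡∂ n).boundary M, ‖x p‖ = euclRadius R :=
    fun p hp => (mem_hypSphere_iff hR _).1 (hbdry p hp)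
  have hsinh : 0 < Real.sinh R := Real.sinh_pos_iff.2 hR
  -- The angle condition multiplied by sinh R: this fixes the constant `c` of the field.
  have hc : ∀ p ∈ (𝓡∂ n).boundary M,
      Real.sinh R * Real.cos θ = -(confFactor (x p) ^ 2 * inner ℝ (ν p) (x p)) := by
    intro p hp
    rw [← hangle p hp, hypMetric, sphereNormal, inner_neg_left, real_inner_smul_right]
    field_simp
  refine h.integral_minkowskiIntegrand_eq_zero fun q y hy hy0 =>
    h.chartVector_zero_eq_zero a hnorm hc (fun p hp heq => ?_) q hy hy0
  -- If `ν` and `x` were parallel at `p`, then cos² θ = 1, which is impossible for θ in (0, π).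
  have h1 := confFactor_mul_norm_sq (hnorm p hp)
  have h2 := hunit p
  rw [hypMetric, real_inner_self_eq_norm_sq] at h2
  have h3 : Real.sinh R ^ 2 * Real.cos θ ^ 2 = Real.sinh R ^ 2 := by
    rw [← mul_pow, hc p hp, neg_sq, mul_pow, heq]
    linear_combination confFactor (x p) ^ 2 * ‖x p‖ ^ 2 * h2 + h1
  have h4 : Real.sinh R ^ 2 * Real.sin θ ^ 2 = 0 := by
    rw [Real.sin_sq]
    linear_combination -h3
  have h5 := Real.sin_pos_of_mem_Ioo hθ
  exact absurd h4 (by positivity)
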